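/- **The formal system.** The finite types are generated from $0$ (numbers) by $\sigma\to\tau$ and $\sigma^{*}$ (finite sequences of objects of type $\sigma$); $1$ abbreviates $0\to0$ and $2$ abbreviates $1\to 0$. The system $\textsf{E-PA}^{\omega*}$ is classical many-sorted predicate logic with equality over these types, with application, zero, successor, the combinators $K,S$, the recursors of Gödel's $\mathsf T$, the empty sequence, the operation prefixing an element to a sequence, and list recursors. Its axioms are the defining equations of these constants, the axioms that $0$ is not a successor and that successor is injective, the axiom that every sequence is empty or arises by prefixing an element to a sequence, extensionality for functions, and induction for all formulas. The system $\mathsf P$ adds a predicate $\mathrm{st}$ at each type; a formula is *internal* if it does not contain $\mathrm{st}$, and $\forall^{\rm st},\exists^{\rm st}$ denote quantification over standard objects. Induction is assumed only for internal formulas, and the further axioms of $\mathsf P$ are: - $\mathrm{st}(x)\wedge x=y\to\mathrm{st}(y)$; $\mathrm{st}(t)$ for each closed term $t$; $\mathrm{st}(f)\wedge\mathrm{st}(x)\to\mathrm{st}(f(x))$; - external induction, for every formula $\Phi$: $\Phi(0)\wedge(\forall^{\rm st}n^0)(\Phi(n)\to\Phi(n+1))\to(\forall^{\rm st}m^0)\Phi(m)$;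 - $\mathsf{HAC}_{\rm int}$, for internal $\varphi$: $(\forall^{\rm st}x^\sigma)(\exists^{\rm st}y^\tau)\varphi(x,y)\to(\exists^{\rm st}F^{\sigma\to\tau^*})(\forall^{\rm st}x^\sigma)(\exists y^\tau\in F(x))\varphi(x,y)$; - idealisation, for internal $\varphi$: $(\forall^{\rm st}x^{\sigma^*})(\exists y^\tau)(\forall z^\sigma\in x)\varphi(z,y)\to(\exists y^\tau)(\forall^{\rm st}x^\sigma)\varphi(x,y)$. All schemas allow parameters. For $f,g$ of type $1$ let $f\approx g$ mean $(\forall^{\rm st}n)(f(n)=g(n))$, let $\overline fN=(f(0),\dots,f(N))$, and for $Y$ of type $2$ let $Y\in C$ mean $(\forall f^1)(\exists N^0)(\forall g^1)(\overline gN=\overline fN\to Y(f)=Y(g))$. Consider the axioms - $\mathsf{NPC}$: $(\forall^{\rm st}Y^2\in C)(\forall^{\rm st}f^1)(\forall g^1)(f\approx g\to Y(f)=Y(g))$; - $\mathsf{STP}$: for every $f^1\le 1$ there is a standard $g^1\le1$ with $f\approx g$. **The functionals.** Below $Y$ has type $2$, $s$ is a finite sequence of numbers (type $0^*$), $|s|$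 is its length, $*$ is concatenation, and $N,M$ are numbers. The functionals $G$ and $H$ are given by the following recursions, for all $Y,s,N,M$: $$G(Y,s,N)=\begin{cases}Y(s*00\dots)&|s|\ge N,\\ Y\big(s*0*(\lambda n)\,G(Y,s*\langle n+1\rangle,N)\big)&\text{otherwise;}\end{cases}$$ $$H(Y,s,M)=\begin{cases}Y(s(0)*\dots*s(M)*00\dots)&|s|\ge M,\\ Y\big(s*0*H(Y,s*\langle1\rangle,M)*\dots*H(Y,s*\langle M\rangle,M)*00\dots\big)&\text{otherwise,}\end{cases}$$ where in the first case of $H$ entries beyond the end of $s$ are read as $0$. For $\Gamma$ of type $2\to(0^*\to0)$ let $\mathsf{GH}_{\rm st}(\Gamma)$ be $$(\forall^{\rm st}Y\in C)(\forall^{\rm st}s)\big[\Gamma(Y,s)=Y\big(s*0*(\lambda n)\,\Gamma(Y,s*\langle n+1\rangle)\big)\big],$$ and let $\mathsf{CA}(\Gamma)$ be: for all standard $Y\in C$, all standard $s$ and all nonstandard $N$, $G(Y,s,N)=H(Y,s,N)=\Gamma(Y,s)$. **Statement.** There are closed terms $t_G$ and $t_H$ of the language of $\textsf{E-PA}^{\omega*}$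 which $\mathsf P$ proves to satisfy the recursions of $G$ and $H$, respectively. Moreover, $\mathsf P+\mathsf{NPC}+\mathsf{STP}$ proves: whenever $G$ and $H$ satisfy these recursions, there is a standard $\Gamma$ with $\mathsf{GH}_{\rm st}(\Gamma)$ and $\mathsf{CA}(\Gamma)$; and every (possibly nonstandard) $\Gamma$ with $\mathsf{GH}_{\rm st}(\Gamma)$ satisfies $\mathsf{CA}(\Gamma)$. -/

import Mathlib

namespace NSA

/-! ### Finite types, terms and formulas -/

/-- The finite types: `0`, function types, and types of finite sequences. -/
inductive Ty : Type
  | nat : Ty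
  | arr : Ty → Ty → Ty
  | seq : Ty → Ty

infixr:60 " ⇒ " => Ty.arr

/-- The type `1` of functions from numbers to numbers. -/
abbrev Ty.one : Ty := Ty.nat ⇒ Ty.nat

/-- The type `2` of functionals from type `1` to numbers. -/
abbrev Ty.two : Ty := Ty.one ⇒ Ty.nat

/-- The type of functionals `(Y, s) ↦ Γ(Y, s)`, with `Y` of type `2` and `s` a finite sequence
of numbers. -/
abbrev Ty.gam : Ty := Ty.two ⇒ Ty.seq Ty.nat ⇒ Ty.nat

/-- The type of functionals `(Y, s, N) ↦ G(Y, s, N)`. -/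
abbrev Ty.appr : Ty := Ty.two ⇒ Ty.seq Ty.nat ⇒ Ty.nat ⇒ Ty.nat

/-- Typed variables, as de Bruijn indices into a context (the list of the types of the variables
that may occur free). -/
inductive Var : List Ty → Ty → Type
  | z {Γ : List Ty} {σ : Ty} : Var (σ :: Γ) σ
  | s {Γ : List Ty} {σ τ : Ty} : Var Γ σ → Var (τ :: Γ) σ

/-- The constants of Gödel's `T` with sequence types: zero, successor, the combinators, the
recursors, the empty sequence, prefixing an element to a sequence, and the list recursors. -/
inductive Cst : Ty → Type
  | zero : Cst Ty.nat
  | succ : Cst (Ty.nat ⇒ Ty.nat)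
  | K (σ τ : Ty) : Cst (σ ⇒ τ ⇒ σ)
  | S (ρ σ τ : Ty) : Cst ((ρ ⇒ σ ⇒ τ) ⇒ (ρ ⇒ σ) ⇒ ρ ⇒ τ)
  | R (ρ : Ty) : Cst (ρ ⇒ (ρ ⇒ Ty.nat ⇒ ρ) ⇒ Ty.nat ⇒ ρ)
  | nil (σ : Ty) : Cst (Ty.seq σ)
  | cons (σ : Ty) : Cst (σ ⇒ Ty.seq σ ⇒ Ty.seq σ)
  | L (σ ρ : Ty) : Cst (ρ ⇒ (ρ ⇒ σ ⇒ ρ) ⇒ Ty.seq σ ⇒ ρ)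

/-- Terms of type `σ` with free variables in the context `Γ`. -/
inductive Tm (Γ : List Ty) : Ty → Type
  | var {σ : Ty} : Var Γ σ → Tm Γ σ
  | cst {σ : Ty} : Cst σ → Tm Γ σ
  | app {σ τ : Ty} : Tm Γ (σ ⇒ τ) → Tm Γ σ → Tm Γ τ

infixl:90 " ⬝ " => Tm.app

/-- Simultaneous substitutions of terms for variables. -/
abbrev Sbst (Γ Δ : List Ty) : Type := ∀ σ : Ty, Var Γ σ → Tm Δ σ

/-- Apply a substitution to a term. -/
def Tm.subst {Γ Δ : List Ty} (θ : Sbst Γ Δ) : {σ : Ty} → Tm Γ σ → Tm Δ σ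
  | _, .var x => θ _ x
  | _, .cst c => .cst c
  | _, .app a b => .app (a.subst θ) (b.subst θ)

/-- The identity substitution into a context with one further variable. -/
def Sbst.shift (Γ : List Ty) (τ : Ty) : Sbst Γ (τ :: Γ) := fun _ x => .var (.s x)

/-- Weakening of a term by one variable. -/
def Tm.wk {Γ : List Ty} {τ σ : Ty} (a : Tm Γ σ) : Tm (τ :: Γ) σ := a.subst (Sbst.shift Γ τ)

/-- Extend a substitution by a term for the variable of index `0`. -/
def Sbst.ext {Γ Δ : List Ty} {τ : Ty} (θ : Sbst Γ Δ) (t : Tm Δ τ) : Sbst (τ :: Γ) Δ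
  | _, .z => t
  | _, .s x => θ _ x

/-- Weaken all terms of a substitution. -/
def Sbst.wk {Γ Δ : List Ty} {τ : Ty} (θ : Sbst Γ Δ) : Sbst Γ (τ :: Δ) := fun _ x => (θ _ x).wk

/-- The identity substitution. -/
def Sbst.id (Γ : List Ty) : Sbst Γ Γ := fun _ x => .var x

/-- The unique substitution on the empty context. -/
def Sbst.empty (Δ : List Ty) : Sbst [] Δ := fun _ x => nomatch x

/-- Formulas with free variables in `Γ`: falsity, implication, equality at every type,
standardness at every type, universal quantification over every type. The other connectives
are defined from these, as usual in classical logic. -/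
inductive Fm : List Ty → Type
  | bot {Γ : List Ty} : Fm Γ
  | imp {Γ : List Ty} : Fm Γ → Fm Γ → Fm Γ
  | eq {Γ : List Ty} {σ : Ty} : Tm Γ σ → Tm Γ σ → Fm Γ
  | st {Γ : List Ty} {σ : Ty} : Tm Γ σ → Fm Γ
  | all {Γ : List Ty} (σ : Ty) : Fm (σ :: Γ) → Fm Γ

namespace Fm

/-- Capture-avoiding substitution in formulas. -/
def subst : {Γ Δ : List Ty} → Sbst Γ Δ → Fm Γ → Fm Δ
  | _, _, _, .bot => .bot
  | _, _, θ, .imp φ ψ => .imp (φ.subst θ) (ψ.subst θ)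
  | _, _, θ, .eq a b => .eq (a.subst θ) (b.subst θ)
  | _, _, θ, .st a => .st (a.subst θ)
  | _, _, θ, .all σ φ => .all σ (φ.subst (θ.wk.ext (.var .z)))

/-- Weakening of a formula by one variable. -/
def wk {Γ : List Ty} {τ : Ty} (φ : Fm Γ) : Fm (τ :: Γ) := φ.subst (Sbst.shift Γ τ)

/-- `φ(t)`: replace the variable of index `0` by `t`. -/
def inst {Γ : List Ty} {τ : Ty} (φ : Fm (τ :: Γ)) (t : Tm Γ τ) : Fm Γ :=
  φ.subst ((Sbst.id Γ).ext t)

/-- Internal formulas: those without the standardness predicate. -/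
def Internal : {Γ : List Ty} → Fm Γ → Prop
  | _, .bot => True
  | _, .imp φ ψ => φ.Internal ∧ ψ.Internal
  | _, .eq _ _ => True
  | _, .st _ => False
  | _, .all _ φ => φ.Internal

/-- The universal closure. -/
def closure : {Γ : List Ty} → Fm Γ → Fm []
  | [], φ => φ
  | σ :: _, φ => closure (.all σ φ)

variable {Γ : List Ty}

/-- Negation. -/
def neg (φ : Fm Γ) : Fm Γ := .imp φ .bot

/-- Conjunction. -/
def and (φ ψ : Fm Γ) : Fm Γ := neg (.imp φ (neg ψ))

/-- Disjunction. -/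
def or (φ ψ : Fm Γ) : Fm Γ := .imp (neg φ) ψ

/-- Existential quantification. -/
def ex (σ : Ty) (φ : Fm (σ :: Γ)) : Fm Γ := neg (.all σ (neg φ))

/-- Quantification over all standard objects of type `σ`. -/
def allst (σ : Ty) (φ : Fm (σ :: Γ)) : Fm Γ := .all σ (.imp (.st (.var .z)) φ)

/-- Existence of a standard object of type `σ`. -/
def exst (σ : Ty) (φ : Fm (σ :: Γ)) : Fm Γ := ex σ (and (.st (.var .z)) φ)

end Fm

/-! ### Derivability -/

/-- Natural deduction for classical many-sorted first-order logic with equality: `Prf T Γ H φ`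
says that `φ` is derivable from the hypotheses `H` and the closed axioms `T`, where the formulas
in `H` and `φ` have their free variables in `Γ`. -/
inductive Prf (T : Set (Fm [])) : (Γ : List Ty) → List (Fm Γ) → Fm Γ → Prop
  | ax {Γ : List Ty} {H : List (Fm Γ)} {φ : Fm []} :
      φ ∈ T → Prf T Γ H (φ.subst (Sbst.empty Γ))
  | hyp {Γ : List Ty} {H : List (Fm Γ)} {φ : Fm Γ} : φ ∈ H → Prf T Γ H φ
  | impI {Γ : List Ty} {H : List (Fm Γ)} {φ ψ : Fm Γ} :
      Prf T Γ (φ :: H) ψ → Prf T Γ H (.imp φ ψ)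
  | impE {Γ : List Ty} {H : List (Fm Γ)} {φ ψ : Fm Γ} :
      Prf T Γ H (.imp φ ψ) → Prf T Γ H φ → Prf T Γ H ψ
  | raa {Γ : List Ty} {H : List (Fm Γ)} {φ : Fm Γ} :
      Prf T Γ (φ.neg :: H) .bot → Prf T Γ H φ
  | allI {Γ : List Ty} {H : List (Fm Γ)} {σ : Ty} {φ : Fm (σ :: Γ)} :
      Prf T (σ :: Γ) (H.map Fm.wk) φ → Prf T Γ H (.all σ φ)
  | allE {Γ : List Ty} {H : List (Fm Γ)} {σ : Ty} {φ : Fm (σ :: Γ)} (t : Tm Γ σ) :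
      Prf T Γ H (.all σ φ) → Prf T Γ H (φ.inst t)
  | eqRefl {Γ : List Ty} {H : List (Fm Γ)} {σ : Ty} (t : Tm Γ σ) : Prf T Γ H (.eq t t)
  | eqSubst {Γ : List Ty} {H : List (Fm Γ)} {σ : Ty} {a b : Tm Γ σ} (φ : Fm (σ :: Γ)) :
      Prf T Γ H (.eq a b) → Prf T Γ H (φ.inst a) → Prf T Γ H (φ.inst b)

/-- The closed formula `φ` is provable from the axioms `T`. -/
def Proves (T : Set (Fm [])) (φ : Fm []) : Prop := Prf T [] [] φ

/-! ### Some primitive recursive operations, as terms -/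

section Terms

variable {Γ : List Ty}

/-- The variable bound by the innermost quantifier. -/
def v0 {σ : Ty} : Tm (σ :: Γ) σ := .var .z
/-- The variable bound by the next quantifier further out. -/
def v1 {σ τ : Ty} : Tm (τ :: σ :: Γ) σ := .var (.s .z)
/-- The variable bound two quantifiers further out. -/
def v2 {σ τ ρ : Ty} : Tm (ρ :: τ :: σ :: Γ) σ := .var (.s (.s .z))
/-- The variable bound three quantifiers further out. -/
def v3 {σ τ ρ π : Ty} : Tm (π :: ρ :: τ :: σ :: Γ) σ := .var (.s (.s (.s .z)))

/-- Lambda abstraction over the variable of index `0`, through the combinators. -/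
def lam {σ : Ty} : {τ : Ty} → Tm (σ :: Γ) τ → Tm Γ (σ ⇒ τ)
  | _, .var .z => .cst (.S σ (σ ⇒ σ) σ) ⬝ .cst (.K σ (σ ⇒ σ)) ⬝ .cst (.K σ σ)
  | τ, .var (.s x) => .cst (.K τ σ) ⬝ .var x
  | τ, .cst c => .cst (.K τ σ) ⬝ .cst c
  | τ, .app (σ := ρ) a b => .cst (.S σ ρ τ) ⬝ lam a ⬝ lam b

/-- The number zero. -/
def zero : Tm Γ Ty.nat := .cst .zero

/-- Successor. -/
def succ (a : Tm Γ Ty.nat) : Tm Γ Ty.nat := .cst .succ ⬝ a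

/-- Recursion: `rec a f 0 = a` and `rec a f (n + 1) = f (rec a f n) n`. -/
def recN {ρ : Ty} (a : Tm Γ ρ) (f : Tm Γ (ρ ⇒ Ty.nat ⇒ ρ)) (n : Tm Γ Ty.nat) : Tm Γ ρ :=
  .cst (.R ρ) ⬝ a ⬝ f ⬝ n

/-- List recursion: `recL a f ⟨⟩ = a` and `recL a f (x :: w) = f (recL a f w) x`. -/
def recL {σ ρ : Ty} (a : Tm Γ ρ) (f : Tm Γ (ρ ⇒ σ ⇒ ρ)) (w : Tm Γ (Ty.seq σ)) : Tm Γ ρ :=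
  .cst (.L σ ρ) ⬝ a ⬝ f ⬝ w

/-- The empty sequence. -/
def nil {σ : Ty} : Tm Γ (Ty.seq σ) := .cst (.nil σ)

/-- Prefix an element to a sequence. -/
def cons {σ : Ty} (a : Tm Γ σ) (w : Tm Γ (Ty.seq σ)) : Tm Γ (Ty.seq σ) := .cst (.cons σ) ⬝ a ⬝ w

/-- Predecessor. -/
def pred (a : Tm Γ Ty.nat) : Tm Γ Ty.nat := recN zero (lam (lam v0)) a

/-- Truncated subtraction. -/
def monus (a b : Tm Γ Ty.nat) : Tm Γ Ty.nat := recN a (lam (lam (pred v1))) b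

/-- `a` if `c = 0`, and `b` otherwise. -/
def ifZero {σ : Ty} (c : Tm Γ Ty.nat) (a b : Tm Γ σ) : Tm Γ σ := recN a (lam (lam b.wk.wk)) c

/-- The length of a sequence. -/
def len {σ : Ty} (w : Tm Γ (Ty.seq σ)) : Tm Γ Ty.nat := recL zero (lam (lam (succ v1))) w

/-- `w * ⟨a⟩`: append the element `a` to the sequence `w`. -/
def snoc {σ : Ty} (w : Tm Γ (Ty.seq σ)) (a : Tm Γ σ) : Tm Γ (Ty.seq σ) :=
  recL (cons a nil) (lam (lam (cons v0 v1))) w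

/-- `w * f`: the infinite sequence that starts with `w` and continues with `f 0, f 1, …`. -/
def cat {σ : Ty} (w : Tm Γ (Ty.seq σ)) (f : Tm Γ (Ty.nat ⇒ σ)) : Tm Γ (Ty.nat ⇒ σ) :=
  recL f (lam (lam (lam (recN v1 (lam (lam (.app (.var (.s (.s (.s (.s .z))))) v0))) v0)))) w

/-- The zero object of each type, used as default value. -/
def dflt : (σ : Ty) → Tm Γ σ
  | .nat => zero
  | .arr σ τ => .cst (.K τ σ) ⬝ dflt τ
  | .seq _ => nil

/-- `w(i)`: the element at place `i` of the sequence `w` (the zero object beyond its end). -/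
def nth {σ : Ty} (w : Tm Γ (Ty.seq σ)) (i : Tm Γ Ty.nat) : Tm Γ σ := cat w (dflt (Ty.nat ⇒ σ)) ⬝ i

end Terms

/-! ### Abbreviations for formulas -/

section Formulas

variable {Γ : List Ty}

open Fm

/-- `a ≤ b`. -/
def le (a b : Tm Γ Ty.nat) : Fm Γ := .eq (monus a b) zero

/-- `a < b`. -/
def lt (a b : Tm Γ Ty.nat) : Fm Γ := le (succ a) b

/-- `r ∈ w`, that is, `w(i) = r` for some `i < |w|`. -/
def mem {σ : Ty} (r : Tm Γ σ) (w : Tm Γ (Ty.seq σ)) : Fm Γ :=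
  ex .nat (and (lt v0 (len w.wk)) (.eq (nth w.wk v0) r.wk))

/-- `f ≈ g` for `f`, `g` of type `1`: equal values at all standard numbers. -/
def approx (f g : Tm Γ Ty.one) : Fm Γ := allst .nat (.eq (f.wk ⬝ v0) (g.wk ⬝ v0))

/-- `f` and `g` have the same initial segment `(f(0), …, f(N)) = (g(0), …, g(N))`. -/
def agree (f g : Tm Γ Ty.one) (N : Tm Γ Ty.nat) : Fm Γ :=
  .all .nat (.imp (le v0 N.wk) (.eq (f.wk ⬝ v0) (g.wk ⬝ v0)))

/-- `f ≤ 1` for `f` of type `1`. -/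
def binary (f : Tm Γ Ty.one) : Fm Γ := .all .nat (le (f.wk ⬝ v0) (succ zero))

/-- `Y ∈ C`, continuity on Baire space: for all `f` there is `N` such that for all `g` that agree
with `f` up to `N`, `Y(f) = Y(g)`. -/
def cont (Y : Tm Γ Ty.two) : Fm Γ :=
  .all .one (ex .nat (.all .one
    (.imp (agree v0 v2 v1) (.eq (Y.wk.wk.wk ⬝ v2) (Y.wk.wk.wk ⬝ v0)))))

end Formulas

/-! ### The system `P` -/

section Axioms

open Fm

/-- Peano arithmetic in all finite types, with sequence types and extensionality. Reflexivity and
the substitution property of equality belong to the logic. -/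
inductive EPA : Set (Fm [])
  | succNeZero : EPA (.all .nat (neg (.eq (succ v0) zero)))
  | succInj : EPA (.all .nat (.all .nat (.imp (.eq (succ v1) (succ v0)) (.eq v1 v0))))
  | induction {Γ : List Ty} (φ : Fm (.nat :: Γ)) (h : φ.Internal) :
      EPA (closure (.imp (φ.inst zero)
        (.imp (.all .nat (.imp φ (φ.subst ((Sbst.shift Γ .nat).ext (succ v0)))))
          (.all .nat φ))))
  | combK (σ τ : Ty) : EPA (.all σ (.all τ (.eq (.cst (.K σ τ) ⬝ v1 ⬝ v0) v1)))
  | combS (ρ σ τ : Ty) :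
      EPA (.all (ρ ⇒ σ ⇒ τ) (.all (ρ ⇒ σ) (.all ρ
        (.eq (.cst (.S ρ σ τ) ⬝ v2 ⬝ v1 ⬝ v0) (v2 ⬝ v0 ⬝ (v1 ⬝ v0))))))
  | recZero (ρ : Ty) :
      EPA (.all ρ (.all (ρ ⇒ .nat ⇒ ρ) (.eq (recN v1 v0 zero) v1)))
  | recSucc (ρ : Ty) :
      EPA (.all ρ (.all (ρ ⇒ .nat ⇒ ρ) (.all .nat
        (.eq (recN v2 v1 (succ v0)) (v1 ⬝ recN v2 v1 v0 ⬝ v0)))))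
  | recNil (σ ρ : Ty) :
      EPA (.all ρ (.all (ρ ⇒ σ ⇒ ρ) (.eq (recL v1 v0 nil) v1)))
  | recCons (σ ρ : Ty) :
      EPA (.all ρ (.all (ρ ⇒ σ ⇒ ρ) (.all σ (.all (.seq σ)
        (.eq (recL v3 v2 (cons v1 v0)) (v2 ⬝ recL v3 v2 v0 ⬝ v1))))))
  | seqCases (σ : Ty) :
      EPA (.all (.seq σ) (or (.eq v0 nil) (ex σ (ex (.seq σ) (.eq v2 (cons v1 v0))))))
  | ext (σ τ : Ty) :
      EPA (.all (σ ⇒ τ) (.all (σ ⇒ τ)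
        (.imp (.all σ (.eq (v2 ⬝ v0) (v1 ⬝ v0))) (.eq v1 v0))))

/-- The system `P`: arithmetic `EPA`, the basic axioms on standardness, external induction, the
Herbrandised axiom of choice for internal formulas, and idealisation. In the last two schemas the
variable of index `0` of `φ` is `y`, that of index `1` is `x`, and the others are parameters. -/
inductive P : Set (Fm [])
  | arith {φ : Fm []} : EPA φ → P φ
  | stEq (σ : Ty) :
      P (.all σ (.all σ (.imp (and (.st v1) (.eq v1 v0)) (.st v0))))
  | stClosed {σ : Ty} (t : Tm [] σ) : P (.st t)
  | stApp (σ τ : Ty) :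
      P (.all (σ ⇒ τ) (.all σ (.imp (and (.st v1) (.st v0)) (.st (v1 ⬝ v0)))))
  | extInduction {Γ : List Ty} (Φ : Fm (.nat :: Γ)) :
      P (closure (.imp (and (Φ.inst zero)
          (allst .nat (.imp Φ (Φ.subst ((Sbst.shift Γ .nat).ext (succ v0))))))
        (allst .nat Φ)))
  | hac {Γ : List Ty} (σ τ : Ty) (φ : Fm (τ :: σ :: Γ)) (h : φ.Internal) :
      P (closure (.imp
        (allst σ (exst τ φ))
        (exst (σ ⇒ .seq τ) (allst σ (ex τ
          (and (mem v0 (v2 ⬝ v1))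
            (φ.subst (((Sbst.id Γ).wk.wk.wk.ext v1).ext v0))))))))
  | idealisation {Γ : List Ty} (σ τ : Ty) (φ : Fm (τ :: σ :: Γ)) (h : φ.Internal) :
      P (closure (.imp
        (allst (.seq σ) (ex τ (.all σ
          (.imp (mem v0 v2) (φ.subst (((Sbst.id Γ).wk.wk.wk.ext v0).ext v1))))))
        (ex τ (allst σ (φ.subst (((Sbst.id Γ).wk.wk.ext v0).ext v1))))))

/-- Nonstandard pointwise continuity: for all standard `Y ∈ C`, standard `f` and all `g`,
`f ≈ g` implies `Y(f) = Y(g)`. -/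
def NPC : Fm [] :=
  allst .two (.imp (cont v0) (allst .one (.all .one
    (.imp (approx v1 v0) (.eq (v2 ⬝ v1) (v2 ⬝ v0))))))

/-- The standard part principle: for every binary `f` there is a standard binary `g`, `f ≈ g`. -/
def STP : Fm [] :=
  .all .one (.imp (binary v0) (exst .one (and (binary v0) (approx v1 v0))))

end Axioms

/-! ### The Gandy-Hyland functional and its canonical approximations -/

section Functionals

variable {Γ : List Ty}

open Fm

/-- `G` satisfies its defining recursion: for all `Y`, `s`, `N`, if `|s| ≥ N` then
`G(Y, s, N) = Y(s * 00…)`, and otherwise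
`G(Y, s, N) = Y(s * 0 * (λ n) G(Y, s * ⟨n + 1⟩, N))`. -/
def recG (G : Tm Γ Ty.appr) : Fm Γ :=
  .all .two (.all (.seq .nat) (.all .nat (and
    (.imp (le v0 (len v1))
      (.eq (G.wk.wk.wk ⬝ v2 ⬝ v1 ⬝ v0) (v2 ⬝ cat v1 (lam zero))))
    (.imp (neg (le v0 (len v1)))
      (.eq (G.wk.wk.wk ⬝ v2 ⬝ v1 ⬝ v0)
        (v2 ⬝ cat (snoc v1 zero) (lam (G.wk.wk.wk.wk ⬝ v3 ⬝ snoc v2 (succ v0) ⬝ v1))))))))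

/-- `H` satisfies its defining recursion: for all `Y`, `s`, `M`, if `|s| ≥ M` then
`H(Y, s, M) = Y(s(0) * … * s(M) * 00…)` (entries beyond the end of `s` read as `0`), and
otherwise `H(Y, s, M) = Y(s * 0 * H(Y, s * ⟨1⟩, M) * … * H(Y, s * ⟨M⟩, M) * 00…)`. -/
def recH (H : Tm Γ Ty.appr) : Fm Γ :=
  .all .two (.all (.seq .nat) (.all .nat (and
    (.imp (le v0 (len v1))
      (.eq (H.wk.wk.wk ⬝ v2 ⬝ v1 ⬝ v0)
        (v2 ⬝ lam (ifZero (monus v0 v1) (nth v2 v0) zero))))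
    (.imp (neg (le v0 (len v1)))
      (.eq (H.wk.wk.wk ⬝ v2 ⬝ v1 ⬝ v0)
        (v2 ⬝ cat (snoc v1 zero)
          (lam (ifZero (monus (succ v0) v1)
            (H.wk.wk.wk.wk ⬝ v3 ⬝ snoc v2 (succ v0) ⬝ v1) zero))))))))

/-- `GH_st(Γ)`: for all standard `Y ∈ C` and standard `s`,
`Γ(Y, s) = Y(s * 0 * (λ n) Γ(Y, s * ⟨n + 1⟩))`. -/
def GHst (F : Tm Γ Ty.gam) : Fm Γ :=
  allst .two (.imp (cont v0) (allst (.seq .nat)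
    (.eq (F.wk.wk ⬝ v1 ⬝ v0)
      (v1 ⬝ cat (snoc v0 zero) (lam (F.wk.wk.wk ⬝ v2 ⬝ snoc v1 (succ v0)))))))

/-- `CA(Γ)`: for all standard `Y ∈ C`, standard `s` and nonstandard `N`,
`G(Y, s, N) = H(Y, s, N) = Γ(Y, s)`. -/
def CA (G H : Tm Γ Ty.appr) (F : Tm Γ Ty.gam) : Fm Γ :=
  allst .two (.imp (cont v0) (allst (.seq .nat) (.all .nat (.imp (neg (.st v0))
    (and
      (.eq (G.wk.wk.wk ⬝ v2 ⬝ v1 ⬝ v0) (H.wk.wk.wk ⬝ v2 ⬝ v1 ⬝ v0))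
      (.eq (H.wk.wk.wk ⬝ v2 ⬝ v1 ⬝ v0) (F.wk.wk.wk ⬝ v2 ⬝ v1)))))))

end Functionals

end NSA

open NSA

/-!
# The Gandy-Hyland functional and its canonical approximations

Provability is treated semantically. `proves_of_forall_sat` is Gödel's completeness theorem for the
calculus, proved with a Henkin chain of contexts and finite sets of hypotheses; the objects of the
term model are coherent sequences of terms. It remains to argue inside an arbitrary model of `P`,
where each appeal to an axiom schema displays the defining formula.

The mathematical core is that `P + NPC` proves that the approximations stabilise.

* By the Herbrandised axiom of choice, `NPC` yields a standard functional giving moduli of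
  continuity at the constant function `0`. No such functional is continuous, and Grilliot's trick
  turns it into a standard functional `E` which decides whether a standard function vanishes
  everywhere (`HasNPC.exists_decide`).
* If a standard function `f` had its only nonzero value at a nonstandard place `m`, then
  `g ↦ E (f restricted to the support of g)` would be standard and continuous, because `E` is only
  ever applied to `0` or to `f`. It would separate `0` from `f`, against `NPC`. This gives transfer
  for universal statements about standard functions (`HasNPC.transfer`), and with choice a standard
  search functional (`HasNPC.exists_search`).
* With the search functional, a standard property of finite sequences that is not true everywhere
  fails along a standard infinite path, on which a standard `Y ∈ C` is eventually secured. This is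
  bar induction, `HasNPC.bar_induction`.
* The statement "`G(Y, s, ·)` is constant from some standard number on" is made into a standard
  property with the search functional. Bar induction proves it, the step being `NPC` at a standard
  function that is infinitely close to the branching, and underspill. The limit is standard and
  satisfies the recursion of the Gandy-Hyland functional (`HasNPC.exists_limit`). The same holds for
  `H`, whose truncation of the branching at a nonstandard place is invisible to `NPC`.
* For a possibly nonstandard `Γ` with the same recursion, the set of sequences at which `Γ` agrees
  with the limit need not be standard. `STP` replaces it, through a coding of sequences by numbers,
  by a standard set with the same standard elements, and bar induction applies again
  (`IsGH.eq_of_st`).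

`G` and `H` are the values of closed terms, hence standard, because their recursions have unique
solutions, by internal induction on `N - |s|` (`isRec_solT`, `IsRec.unique`).
-/

namespace NSA

/-! ### Substitution -/

/-- Composition of substitutions. -/
def Sbst.comp {Γ Δ E : List Ty} (θ : Sbst Γ Δ) (η : Sbst Δ E) : Sbst Γ E :=
  fun _ x => (θ _ x).subst η

/-- The substitution under a binder. -/
abbrev Sbst.up {Γ Δ : List Ty} (τ : Ty) (θ : Sbst Γ Δ) : Sbst (τ :: Γ) (τ :: Δ) :=
  θ.wk.ext (.var .z)

theorem Tm.subst_subst {Γ Δ E : List Ty} (θ : Sbst Γ Δ) (η : Sbst Δ E) {σ : Ty} (t : Tm Γ σ) :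
    (t.subst θ).subst η = t.subst (θ.comp η) := by
  induction t with
  | var x => rfl
  | cst c => rfl
  | app a b iha ihb => simp only [Tm.subst, iha, ihb]

theorem Tm.subst_id {Γ : List Ty} {σ : Ty} (t : Tm Γ σ) : t.subst (Sbst.id Γ) = t := by
  induction t with
  | var x => rfl
  | cst c => rfl
  | app a b iha ihb => simp only [Tm.subst, iha, ihb]

theorem Sbst.hext {Γ Δ : List Ty} {τ : Ty} {θ η : Sbst (τ :: Γ) Δ}
    (h0 : θ _ .z = η _ .z) (hs : ∀ σ (x : Var Γ σ), θ _ (.s x) = η _ (.s x)) : θ = η := by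
  funext σ x
  cases x with
  | z => exact h0
  | s x => exact hs _ x

theorem Tm.wk_subst_ext {Γ Δ : List Ty} (θ : Sbst Γ Δ) {σ τ : Ty} (t : Tm Γ σ) (u : Tm Δ τ) :
    t.wk.subst (θ.ext u) = t.subst θ := by
  rw [Tm.wk, Tm.subst_subst]; rfl

theorem Tm.wk_subst_up {Γ Δ : List Ty} (θ : Sbst Γ Δ) {σ τ : Ty} (t : Tm Γ σ) :
    t.wk.subst (θ.up τ) = (t.subst θ).wk := by
  rw [Tm.wk_subst_ext, Tm.wk, Tm.subst_subst]; rfl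

theorem Sbst.up_comp_up {Γ Δ E : List Ty} (θ : Sbst Γ Δ) (η : Sbst Δ E) (τ : Ty) :
    (θ.up τ).comp (η.up τ) = (θ.comp η).up τ :=
  Sbst.hext rfl fun _ x => Tm.wk_subst_up η (θ _ x)

theorem Sbst.up_comp_ext {Γ Δ E : List Ty} (θ : Sbst Γ Δ) (η : Sbst Δ E) {τ : Ty} (u : Tm E τ) :
    (θ.up τ).comp (η.ext u) = (θ.comp η).ext u :=
  Sbst.hext rfl fun _ x => Tm.wk_subst_ext η (θ _ x) u

theorem Sbst.up_id (Γ : List Ty) (τ : Ty) : (Sbst.id Γ).up τ = Sbst.id (τ :: Γ) :=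
  Sbst.hext rfl fun _ _ => rfl

theorem Sbst.comp_id {Γ Δ : List Ty} (θ : Sbst Γ Δ) : θ.comp (Sbst.id Δ) = θ := by
  funext σ x; exact Tm.subst_id _

namespace Fm

theorem subst_subst {Γ Δ E : List Ty} (θ : Sbst Γ Δ) (η : Sbst Δ E) (φ : Fm Γ) :
    (φ.subst θ).subst η = φ.subst (θ.comp η) := by
  induction φ generalizing Δ E with
  | bot => rfl
  | imp φ ψ h1 h2 => simp only [subst, h1, h2]
  | eq a b => simp only [subst, Tm.subst_subst]
  | st a => simp only [subst, Tm.subst_subst]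
  | all σ φ ih => simp only [subst, ih, Sbst.up_comp_up]

theorem subst_id {Γ : List Ty} (φ : Fm Γ) : φ.subst (Sbst.id Γ) = φ := by
  induction φ with
  | bot => rfl
  | imp φ ψ h1 h2 => simp only [subst, h1, h2]
  | eq a b => simp only [subst, Tm.subst_id]
  | st a => simp only [subst, Tm.subst_id]
  | all σ φ ih => simp only [subst, Sbst.up_id, ih]

theorem wk_subst_ext {Γ Δ : List Ty} (θ : Sbst Γ Δ) {τ : Ty} (φ : Fm Γ) (u : Tm Δ τ) :
    φ.wk.subst (θ.ext u) = φ.subst θ := by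
  rw [wk, subst_subst]; rfl

theorem wk_subst_up {Γ Δ : List Ty} (θ : Sbst Γ Δ) {τ : Ty} (φ : Fm Γ) :
    φ.wk.subst (θ.up τ) = (φ.subst θ).wk := by
  rw [wk_subst_ext, wk, subst_subst]; rfl

theorem inst_wk {Γ : List Ty} {τ : Ty} (φ : Fm Γ) (u : Tm Γ τ) : φ.wk.inst u = φ := by
  rw [inst, wk_subst_ext, subst_id]

theorem up_inst {Γ Δ : List Ty} (θ : Sbst Γ Δ) {τ : Ty} (φ : Fm (τ :: Γ)) (u : Tm Δ τ) :
    (φ.subst (θ.up τ)).inst u = φ.subst (θ.ext u) := by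
  rw [inst, subst_subst, Sbst.up_comp_ext, Sbst.comp_id]

theorem inst_subst {Γ Δ : List Ty} (θ : Sbst Γ Δ) {τ : Ty} (φ : Fm (τ :: Γ)) (u : Tm Γ τ) :
    (φ.inst u).subst θ = (φ.subst (θ.up τ)).inst (u.subst θ) := by
  rw [up_inst, inst, subst_subst]
  congr 1
  exact Sbst.hext rfl fun _ _ => rfl

/-- Weakening of a formula by a variable inserted below the variable of index `0`. -/
def wkUnder {Γ : List Ty} (τ : Ty) {σ : Ty} (φ : Fm (σ :: Γ)) : Fm (σ :: τ :: Γ) :=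
  φ.subst ((Sbst.shift Γ τ).up σ)

theorem wkUnder_inst_z {Γ : List Ty} {σ : Ty} (φ : Fm (σ :: Γ)) :
    (φ.wkUnder σ).inst (.var .z) = φ := by
  rw [wkUnder, up_inst]
  conv_rhs => rw [← subst_id φ]
  congr 1
  exact Sbst.hext rfl fun _ _ => rfl

end Fm

/-! ### Structural properties of derivability -/

namespace Prf

variable {T : Set (Fm [])}

theorem mono {Γ : List Ty} {H : List (Fm Γ)} {φ : Fm Γ} (h : Prf T Γ H φ) :
    ∀ {H' : List (Fm Γ)}, H ⊆ H' → Prf T Γ H' φ := by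
  induction h with
  | ax h => intro _ _; exact .ax h
  | hyp h => intro _ hs; exact .hyp (hs h)
  | impI _ ih => intro _ hs; exact .impI (ih (List.cons_subset_cons _ hs))
  | impE _ _ h1 h2 => intro _ hs; exact .impE (h1 hs) (h2 hs)
  | raa _ ih => intro _ hs; exact .raa (ih (List.cons_subset_cons _ hs))
  | allI _ ih => intro _ hs; exact .allI (ih (List.map_subset _ hs))
  | allE t _ ih => intro _ hs; exact .allE t (ih hs)
  | eqRefl t => intro _ _; exact .eqRefl t
  | eqSubst φ _ _ h1 h2 => intro _ hs; exact .eqSubst φ (h1 hs) (h2 hs)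

theorem subst {Γ : List Ty} {H : List (Fm Γ)} {φ : Fm Γ} (h : Prf T Γ H φ) :
    ∀ {Δ : List Ty} (θ : Sbst Γ Δ), Prf T Δ (H.map (Fm.subst θ)) (φ.subst θ) := by
  induction h with
  | ax h =>
    intro Δ θ
    rw [Fm.subst_subst]
    convert Prf.ax h
    funext σ x; cases x
  | hyp h => intro _ θ; exact .hyp (List.mem_map_of_mem h)
  | impI _ ih => intro _ θ; exact .impI (ih θ)
  | impE _ _ h1 h2 => intro _ θ; exact .impE (h1 θ) (h2 θ)
  | raa _ ih => intro _ θ; exact .raa (ih θ)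
  | @allI Γ H σ φ _ ih =>
    intro _ θ
    refine .allI ?_
    have := ih (θ.up σ)
    rw [List.map_map] at this ⊢
    convert this using 2
    funext ψ
    exact (Fm.wk_subst_up θ ψ).symm
  | allE t _ ih =>
    intro _ θ
    rw [Fm.inst_subst]
    exact .allE _ (ih θ)
  | eqRefl t => intro _ _; exact .eqRefl _
  | eqSubst φ _ _ h1 h2 =>
    intro _ θ
    have h3 := h2 θ
    rw [Fm.inst_subst] at h3 ⊢
    exact .eqSubst _ (h1 θ) h3

variable {Γ : List Ty} {H : List (Fm Γ)}

theorem wk {φ : Fm Γ} (h : Prf T Γ H φ) (τ : Ty) : Prf T (τ :: Γ) (H.map Fm.wk) φ.wk :=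
  h.subst _

theorem botE {φ : Fm Γ} (h : Prf T Γ H .bot) : Prf T Γ H φ :=
  .raa (h.mono (List.subset_cons_self _ _))

theorem eqSymm {σ : Ty} {a b : Tm Γ σ} (h : Prf T Γ H (.eq a b)) : Prf T Γ H (.eq b a) := by
  have := Prf.eqSubst (.eq v0 a.wk) h
  simp only [Fm.inst, Fm.subst, Tm.wk_subst_ext, Tm.subst_id, v0, Tm.subst, Sbst.ext] at this
  exact this (.eqRefl a)

theorem eqTrans {σ : Ty} {a b c : Tm Γ σ} (h : Prf T Γ H (.eq a b)) (h' : Prf T Γ H (.eq b c)) :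
    Prf T Γ H (.eq a c) := by
  have := Prf.eqSubst (.eq a.wk v0) h'
  simp only [Fm.inst, Fm.subst, Tm.wk_subst_ext, Tm.subst_id, v0, Tm.subst, Sbst.ext] at this
  exact this h

theorem eqApp {σ τ : Ty} {a b : Tm Γ (σ ⇒ τ)} {c d : Tm Γ σ} (h : Prf T Γ H (.eq a b))
    (h' : Prf T Γ H (.eq c d)) : Prf T Γ H (.eq (a ⬝ c) (b ⬝ d)) := by
  have h1 := Prf.eqSubst (.eq (a ⬝ c).wk (v0 ⬝ c.wk)) h
  have h2 := Prf.eqSubst (.eq (a ⬝ c).wk (b.wk ⬝ v0)) h'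
  simp only [Fm.inst, Fm.subst, Tm.wk_subst_ext, Tm.subst_id, v0, Tm.subst, Sbst.ext] at h1 h2
  exact h2 (h1 (.eqRefl _))

theorem stCongr {σ : Ty} {a b : Tm Γ σ} (h : Prf T Γ H (.eq a b)) (h' : Prf T Γ H (.st a)) :
    Prf T Γ H (.st b) :=
  .eqSubst (.st v0) h h'

end Prf

end NSA

namespace NSA
open Filter

/-! ### Structures and satisfaction -/

/-- A structure for the language: a carrier for each type, an interpretation of application,
of the constants and of standardness. Equality is interpreted as identity. -/
structure Str where
  /-- The objects of each type. -/
  El : Ty → Type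
  /-- Application. -/
  app : {σ τ : Ty} → El (σ ⇒ τ) → El σ → El τ
  /-- The values of the constants. -/
  cst : {σ : Ty} → Cst σ → El σ
  /-- The standard objects. -/
  st : {σ : Ty} → El σ → Prop

/-- Assignments of objects to the variables of a context. -/
abbrev Env (M : Str) (Γ : List Ty) : Type := ∀ σ : Ty, Var Γ σ → M.El σ

namespace Env

variable {M : Str}

/-- The assignment on the empty context. -/
def nil : Env M [] := fun _ x => nomatch x

/-- Extend an assignment by an object for the variable of index `0`. -/
def ext {Γ : List Ty} {τ : Ty} (e : Env M Γ) (a : M.El τ) : Env M (τ :: Γ)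
  | _, .z => a
  | _, .s x => e _ x

theorem eq_nil (e : Env M []) : e = nil := by
  funext σ x; cases x

theorem hext {Γ : List Ty} {τ : Ty} {e f : Env M (τ :: Γ)}
    (h0 : e _ .z = f _ .z) (hs : ∀ σ (x : Var Γ σ), e _ (.s x) = f _ (.s x)) : e = f := by
  funext σ x
  cases x with
  | z => exact h0
  | s x => exact hs _ x

end Env

/-- The value of a term under an assignment. -/
def Tm.eval {M : Str} {Γ : List Ty} (e : Env M Γ) : {σ : Ty} → Tm Γ σ → M.El σ
  | _, .var x => e _ x
  | _, .cst c => M.cst c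
  | _, .app a b => M.app (a.eval e) (b.eval e)

/-- Satisfaction of a formula under an assignment. -/
def Fm.Sat {M : Str} : {Γ : List Ty} → Env M Γ → Fm Γ → Prop
  | _, _, .bot => False
  | _, e, .imp φ ψ => φ.Sat e → ψ.Sat e
  | _, e, .eq a b => a.eval e = b.eval e
  | _, e, .st a => M.st (a.eval e)
  | _, e, .all _ φ => ∀ a, φ.Sat (e.ext a)

/-! ### Countability of the language -/

theorem countable_of_size {α : Type} (f : α → ℕ) (h : ∀ n, {a | f a < n}.Countable) :
    Countable α := by
  rw [← Set.countable_univ_iff]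
  refine (Set.countable_iUnion h).mono fun a _ => ?_
  exact Set.mem_iUnion.2 ⟨f a + 1, Nat.lt_succ_self _⟩

instance : Countable Ty := by
  refine countable_of_size sizeOf fun n => ?_
  induction n with
  | zero => simp
  | succ n ih =>
    refine ((Set.countable_singleton Ty.nat).union
      ((ih.image2 ih Ty.arr).union (ih.image Ty.seq))).mono ?_
    intro t ht
    cases t with
    | nat => simp
    | arr a b =>
      simp only [Set.mem_ofPred_eq, Ty.arr.sizeOf_spec] at ht
      exact .inr (.inl ⟨a, by simp only [Set.mem_ofPred_eq]; omega, b,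
        by simp only [Set.mem_ofPred_eq]; omega, rfl⟩)
    | seq a =>
      simp only [Set.mem_ofPred_eq, Ty.seq.sizeOf_spec] at ht
      exact .inr (.inr ⟨a, by simp only [Set.mem_ofPred_eq]; omega, rfl⟩)

instance (Γ : List Ty) (σ : Ty) : Countable (Var Γ σ) := by
  refine countable_of_size sizeOf fun n => ?_
  induction n generalizing Γ with
  | zero => simp
  | succ n ih =>
    cases Γ with
    | nil => exact (Set.countable_empty).mono fun x _ => nomatch x
    | cons τ Γ =>
      have hz : {x : Var (τ :: Γ) σ | ∀ y, x ≠ .s y}.Subsingleton := by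
        intro x hx y hy
        cases x with
        | s x => exact absurd rfl (hx x)
        | z =>
          cases y with
          | z => rfl
          | s y => exact absurd rfl (hy y)
      refine (hz.countable.union ((ih Γ).image .s)).mono ?_
      intro x hx
      by_cases h : ∀ y, x ≠ .s y
      · exact .inl h
      · push Not at h
        obtain ⟨y, rfl⟩ := h
        simp only [Set.mem_ofPred_eq, Var.s.sizeOf_spec] at hx
        exact .inr ⟨y, by simp only [Set.mem_ofPred_eq]; omega, rfl⟩

instance : Countable (Σ σ, Cst σ) := by
  rw [← Set.countable_univ_iff]
  have h1 : (Set.range fun p : Ty × Ty × Ty => (⟨_, .S p.1 p.2.1 p.2.2⟩ : Σ σ, Cst σ)).Countable :=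
    Set.countable_range _
  have h2 : (Set.range fun p : Ty × Ty => (⟨_, .K p.1 p.2⟩ : Σ σ, Cst σ)).Countable :=
    Set.countable_range _
  have h3 : (Set.range fun p : Ty × Ty => (⟨_, .L p.1 p.2⟩ : Σ σ, Cst σ)).Countable :=
    Set.countable_range _
  have h4 : (Set.range fun p : Ty => (⟨_, .R p⟩ : Σ σ, Cst σ)).Countable := Set.countable_range _
  have h5 : (Set.range fun p : Ty => (⟨_, .nil p⟩ : Σ σ, Cst σ)).Countable :=
    Set.countable_range _
  have h6 : (Set.range fun p : Ty => (⟨_, .cons p⟩ : Σ σ, Cst σ)).Countable :=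
    Set.countable_range _
  have h7 : ({⟨_, .zero⟩, ⟨_, .succ⟩} : Set (Σ σ, Cst σ)).Countable := by simp
  refine (h1.union (h2.union (h3.union (h4.union (h5.union (h6.union h7)))))).mono ?_
  rintro ⟨_, c⟩ -
  cases c with
  | zero => simp
  | succ => simp
  | K σ τ => exact .inr (.inl ⟨(σ, τ), rfl⟩)
  | S ρ σ τ => exact .inl ⟨(ρ, σ, τ), rfl⟩
  | R ρ => exact .inr (.inr (.inr (.inl ⟨ρ, rfl⟩)))
  | nil σ => exact .inr (.inr (.inr (.inr (.inl ⟨σ, rfl⟩))))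
  | cons σ => exact .inr (.inr (.inr (.inr (.inr (.inl ⟨σ, rfl⟩)))))
  | L σ ρ => exact .inr (.inr (.inl ⟨(σ, ρ), rfl⟩))

instance (σ : Ty) : Countable (Cst σ) :=
  Function.Injective.countable (f := fun c => (⟨σ, c⟩ : Σ σ, Cst σ)) fun a b h => by
    simpa using h

instance (Γ : List Ty) (σ : Ty) : Countable (Tm Γ σ) := by
  refine countable_of_size sizeOf fun n => ?_
  induction n generalizing σ with
  | zero => simp
  | succ n ih =>
    refine ((Set.countable_range Tm.var).union ((Set.countable_range Tm.cst).union
      (Set.countable_iUnion fun ρ => (ih (ρ ⇒ σ)).image2 (ih ρ) Tm.app))).mono ?_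
    intro t ht
    cases t with
    | var x => exact .inl ⟨x, rfl⟩
    | cst x => exact .inr (.inl ⟨x, rfl⟩)
    | app a b =>
      simp only [Set.mem_ofPred_eq, Tm.app.sizeOf_spec] at ht
      exact .inr (.inr (Set.mem_iUnion.2 ⟨_, a, by simp only [Set.mem_ofPred_eq]; omega, b,
        by simp only [Set.mem_ofPred_eq]; omega, rfl⟩))

instance (Γ : List Ty) : Countable (Fm Γ) := by
  refine countable_of_size sizeOf fun n => ?_
  induction n generalizing Γ with
  | zero => simp
  | succ n ih =>
    refine ((Set.countable_singleton Fm.bot).union (((ih Γ).image2 (ih Γ) Fm.imp).union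
      ((Set.countable_iUnion fun σ => (Set.countable_range fun p : Tm Γ σ × Tm Γ σ =>
        Fm.eq p.1 p.2)).union
      ((Set.countable_iUnion fun σ => (Set.countable_range fun p : Tm Γ σ => Fm.st p)).union
      (Set.countable_iUnion fun σ => (ih (σ :: Γ)).image (Fm.all σ)))))).mono ?_
    intro t ht
    cases t with
    | bot => exact .inl rfl
    | imp a b =>
      simp only [Set.mem_ofPred_eq, Fm.imp.sizeOf_spec] at ht
      exact .inr (.inl ⟨a, by simp only [Set.mem_ofPred_eq]; omega, b,
        by simp only [Set.mem_ofPred_eq]; omega, rfl⟩)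
    | eq a b => exact .inr (.inr (.inl (Set.mem_iUnion.2 ⟨_, (a, b), rfl⟩)))
    | st a => exact .inr (.inr (.inr (.inl (Set.mem_iUnion.2 ⟨_, a, rfl⟩))))
    | all σ a =>
      simp only [Set.mem_ofPred_eq, Fm.all.sizeOf_spec] at ht
      exact .inr (.inr (.inr (.inr (Set.mem_iUnion.2
        ⟨σ, a, by simp only [Set.mem_ofPred_eq]; omega, rfl⟩))))

/-! ### Henkin chains -/

/-- An increasing chain of consistent finite sets of hypotheses `H n` in growing contexts `Γ n`
that decides every universal formula, and contains a counterexample to each universal formula that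
it refutes. -/
structure HenkinChain (T : Set (Fm [])) where
  /-- The contexts. -/
  Γ : ℕ → List Ty
  /-- The hypotheses. -/
  H : ∀ n, List (Fm (Γ n))
  /-- The inclusion of each context in the next one. -/
  sh : ∀ n, Sbst (Γ n) (Γ (n + 1))
  mono : ∀ {n} {φ : Fm (Γ n)}, Prf T _ (H n) φ → Prf T _ (H (n + 1)) (φ.subst (sh n))
  consistent : ∀ n, ¬ Prf T _ (H n) .bot
  henkin : ∀ {σ : Ty} (N : ℕ) (φ : ∀ n, Fm (σ :: Γ n)),
    (∀ n, N ≤ n → φ (n + 1) = (φ n).subst ((sh n).up σ)) →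
    (∃ n, N ≤ n ∧ Prf T _ (H n) (.all σ (φ n))) ∨
      ∃ n, N ≤ n ∧ ∃ t, Prf T _ (H n) ((φ n).inst t).neg

namespace HenkinChain

variable {T : Set (Fm [])} (C : HenkinChain T)

/-- A sequence of terms is coherent if it is, from some point on, a single term seen in growing
contexts. -/
def Coh {σ : Ty} (a : ∀ n, Tm (C.Γ n) σ) : Prop :=
  ∀ᶠ n in atTop, a (n + 1) = (a n).subst (C.sh n)

/-- The formulas `φ n` are derivable from some point on. -/
def Holds (φ : ∀ n, Fm (C.Γ n)) : Prop := ∀ᶠ n in atTop, Prf T _ (C.H n) (φ n)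

theorem holds_of_prf {φ : ∀ n, Fm (C.Γ n)} {N : ℕ}
    (h : ∀ n, N ≤ n → φ (n + 1) = (φ n).subst (C.sh n)) (h' : Prf T _ (C.H N) (φ N)) :
    C.Holds φ := by
  refine eventually_atTop.2 ⟨N, fun n hn => ?_⟩
  induction n, hn using Nat.le_induction with
  | base => exact h'
  | succ n hn ih => rw [h n hn]; exact C.mono ih

theorem exists_coh {σ : Ty} {N : ℕ} (t : Tm (C.Γ N) σ) :
    ∃ a : ∀ n, Tm (C.Γ n) σ, a N = t ∧ ∀ n, N ≤ n → a (n + 1) = (a n).subst (C.sh n) := by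
  refine ⟨fun n => if h : N ≤ n then
    Nat.leRecOn (C := fun k => Tm (C.Γ k) σ) h (fun {k} u => u.subst (C.sh k)) t else dflt σ,
    ?_, fun n hn => ?_⟩
  · simp only [le_refl, dite_true, Nat.leRecOn_self]
  · simp only [hn, hn.trans n.le_succ, dite_true]
    rw [Nat.leRecOn_succ hn]

/-- The objects of type `σ` are represented by coherent sequences of terms. -/
abbrev Rep (σ : Ty) : Type := {a : ∀ n, Tm (C.Γ n) σ // C.Coh a}

instance repSetoid (σ : Ty) : Setoid (C.Rep σ) where
  r a b := C.Holds fun n => .eq (a.1 n) (b.1 n)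
  iseqv :=
    { refl := fun _ => .of_forall fun _ => .eqRefl _
      symm := fun h => h.mono fun _ h => h.eqSymm
      trans := fun h h' => (h.and h').mono fun _ h => h.1.eqTrans h.2 }

/-- Application of representatives. -/
def repApp {σ τ : Ty} (a : C.Rep (σ ⇒ τ)) (b : C.Rep σ) : C.Rep τ :=
  ⟨fun n => a.1 n ⬝ b.1 n, (a.2.and b.2).mono fun n h => by simp only [h.1, h.2]; rfl⟩

/-- The term model of a Henkin chain. -/
def model : Str where
  El σ := Quotient (C.repSetoid σ)
  app := Quotient.map₂ C.repApp fun _ _ h _ _ h' => (h.and h').mono fun _ h => h.1.eqApp h.2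
  cst c := Quotient.mk _ ⟨fun _ => .cst c, .of_forall fun _ => rfl⟩
  st := Quotient.lift (fun a => C.Holds fun n => .st (a.1 n)) fun _ _ h => propext
    ⟨fun h' => (h.and h').mono fun _ h => h.1.stCongr h.2,
      fun h' => (h.and h').mono fun _ h => h.1.eqSymm.stCongr h.2⟩

/-- A sequence of substitutions is coherent if all its terms are, from a common point on. -/
def CohS {Δ : List Ty} (θ : ∀ n, Sbst Δ (C.Γ n)) : Prop :=
  ∀ᶠ n in atTop, θ (n + 1) = (θ n).comp (C.sh n)

/-- The assignment in the term model represented by a coherent sequence of substitutions. -/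
def env {Δ : List Ty} (θ : ∀ n, Sbst Δ (C.Γ n)) (h : C.CohS θ) : Env C.model Δ :=
  fun σ x => Quotient.mk (C.repSetoid σ) ⟨fun n => θ n σ x, h.mono fun n h => by simp only [h]; rfl⟩

theorem eval_env {Δ : List Ty} (θ : ∀ n, Sbst Δ (C.Γ n)) (h : C.CohS θ) {σ : Ty} (t : Tm Δ σ) :
    t.eval (C.env θ h) = Quotient.mk (C.repSetoid σ) ⟨fun n => t.subst (θ n),
      h.mono fun n h => by simp only [h, Tm.subst_subst]⟩ := by
  induction t with
  | var x => rfl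
  | cst c => rfl
  | app a b iha ihb => rw [Tm.eval, iha, ihb]; rfl

theorem cohS_ext {Δ : List Ty} {θ : ∀ n, Sbst Δ (C.Γ n)} (h : C.CohS θ) {σ : Ty}
    {a : ∀ n, Tm (C.Γ n) σ} (ha : C.Coh a) : C.CohS fun n => (θ n).ext (a n) :=
  (h.and ha).mono fun n h => by
    simp only [h.1, h.2]
    exact Sbst.hext rfl fun _ _ => rfl

theorem env_ext {Δ : List Ty} {θ : ∀ n, Sbst Δ (C.Γ n)} (h : C.CohS θ) {σ : Ty}
    {a : ∀ n, Tm (C.Γ n) σ} (ha : C.Coh a) :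
    C.env _ (C.cohS_ext h ha) = (C.env θ h).ext (Quotient.mk (C.repSetoid σ) ⟨a, ha⟩) :=
  Env.hext rfl fun _ _ => rfl

theorem not_holds_and {φ : ∀ n, Fm (C.Γ n)} (h : C.Holds φ) (h' : C.Holds fun n => (φ n).neg) :
    False := by
  obtain ⟨n, h1, h2⟩ := (h.and h').exists
  exact C.consistent n (.impE h2 h1)

/-- A coherent sequence of formulas is decided by the chain. -/
theorem holds_or {N : ℕ} {φ : ∀ n, Fm (C.Γ n)}
    (h : ∀ n, N ≤ n → φ (n + 1) = (φ n).subst (C.sh n)) :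
    C.Holds φ ∨ C.Holds fun n => (φ n).neg := by
  -- the vacuous quantification of `φ n` over the numbers is decided
  rcases C.henkin (σ := .nat) N (fun n => (φ n).wk)
    (fun n hn => by rw [h n hn, Fm.wk_subst_up]) with ⟨n, hn, h1⟩ | ⟨n, hn, t, h1⟩
  · left
    refine C.holds_of_prf (fun m hm => h m (hn.trans hm)) ?_
    have := Prf.allE zero h1
    rwa [Fm.inst_wk] at this
  · right
    rw [Fm.inst_wk] at h1
    refine C.holds_of_prf (N := n) (fun m hm => ?_) h1
    rw [h m (hn.trans hm)]; rfl

/-- The truth lemma. -/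
theorem sat_env {Δ : List Ty} (φ : Fm Δ) (θ : ∀ n, Sbst Δ (C.Γ n)) (h : C.CohS θ) :
    φ.Sat (C.env θ h) ↔ C.Holds fun n => φ.subst (θ n) := by
  have coh {Δ : List Ty} (φ : Fm Δ) {θ : ∀ n, Sbst Δ (C.Γ n)} (h : C.CohS θ) :
      ∃ N, ∀ n, N ≤ n → φ.subst (θ (n + 1)) = (φ.subst (θ n)).subst (C.sh n) := by
    obtain ⟨N, hN⟩ := eventually_atTop.1 h
    exact ⟨N, fun n hn => by rw [hN n hn, Fm.subst_subst]⟩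
  induction φ with
  | bot =>
    refine ⟨False.elim, fun h => ?_⟩
    obtain ⟨n, h⟩ := h.exists
    exact C.consistent n h
  | imp φ ψ h1 h2 =>
    refine ⟨fun h' => ?_, fun h3 h4 => (h2 θ h).2 ((h3.and ((h1 θ h).1 h4)).mono fun n h =>
      .impE h.1 h.2)⟩
    obtain ⟨N, hN⟩ := coh φ h
    rcases C.holds_or (φ := fun n => φ.subst (θ n)) hN with h3 | h3
    · exact ((h2 θ h).1 (h' ((h1 θ h).2 h3))).mono fun n h => .impI (h.mono (List.subset_cons_self _ _))
    · exact h3.mono fun n h => .impI (.botE (.impE (h.mono (List.subset_cons_self _ _))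
        (.hyp (List.mem_cons_self ..))))
  | eq a b => rw [Fm.Sat, eval_env, eval_env]; exact Quotient.eq
  | st a => rw [Fm.Sat, eval_env]; rfl
  | @all Δ σ φ ih =>
    constructor
    · intro hs
      obtain ⟨N, hN⟩ := eventually_atTop.1 h
      have hup : ∀ n, N ≤ n → φ.subst ((θ (n + 1)).up σ) =
          (φ.subst ((θ n).up σ)).subst ((C.sh n).up σ) := fun n hn => by
        rw [hN n hn, Fm.subst_subst, Sbst.up_comp_up]
      rcases C.henkin N (fun n => φ.subst ((θ n).up σ)) hup with ⟨n, hn, h1⟩ | ⟨n, hn, t, h1⟩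
      · exact C.holds_of_prf (φ := fun n => (Fm.all σ φ).subst (θ n)) (N := n)
          (fun m hm => congrArg (Fm.all σ) (hup m (hn.trans hm))) h1
      · exfalso
        obtain ⟨a, rfl, ha⟩ := C.exists_coh t
        have hca : C.Coh a := eventually_atTop.2 ⟨n, ha⟩
        have h2 := hs (Quotient.mk (C.repSetoid σ) ⟨a, hca⟩)
        rw [← C.env_ext h hca] at h2
        refine C.not_holds_and ((ih _ (C.cohS_ext h hca)).1 h2) (C.holds_of_prf (N := n) (fun m hm => ?_) ?_)
        · rw [ha m hm, hN m (hn.trans hm)]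
          simp only [Fm.neg, Fm.subst, Fm.subst_subst]
          congr 2
          exact Sbst.hext rfl fun _ _ => rfl
        · rwa [Fm.up_inst] at h1
    · intro hs x
      induction x using Quotient.inductionOn with
      | h a =>
        change φ.Sat ((C.env θ h).ext (Quotient.mk (C.repSetoid σ) ⟨a.1, a.2⟩))
        rw [← C.env_ext h a.2]
        refine (ih _ (C.cohS_ext h a.2)).2 (hs.mono fun n hn => by
        have := Prf.allE (a.1 n) hn
        rwa [Fm.up_inst] at this)

end HenkinChain

/-! ### Construction of a Henkin chain -/

/-- A universal formula to be decided, without its quantifier. -/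
abbrev Task (Γ : List Ty) : Type := Σ σ, Fm (σ :: Γ)

instance (Γ : List Ty) : Nonempty (Task Γ) := ⟨⟨.nat, .bot⟩⟩

/-- An enumeration of all tasks in a context. -/
noncomputable def taskEnum (Γ : List Ty) : ℕ → Task Γ := (exists_surjective_nat (Task Γ)).choose

theorem taskEnum_surjective (Γ : List Ty) : Function.Surjective (taskEnum Γ) :=
  (exists_surjective_nat (Task Γ)).choose_spec

/-- A stage in the construction of a Henkin chain. -/
structure Stage where
  /-- The context. -/
  Γ : List Ty
  /-- The hypotheses. -/
  H : List (Fm Γ)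
  /-- The tasks; those which the `n`-th stage has added are at the places `Nat.pair n j`. -/
  Q : ℕ → Task Γ

namespace Stage

variable (T : Set (Fm []))

open Classical in
/-- Decide a task: add the universal formula if this is consistent, and otherwise a
counterexample. -/
noncomputable def decideTask {Γ : List Ty} (H : List (Fm Γ)) (q : Task Γ) : List (Fm (q.1 :: Γ)) :=
  if Prf T Γ (.all q.1 q.2 :: H) .bot then q.2.neg :: H.map Fm.wk
  else Fm.wk (.all q.1 q.2) :: H.map Fm.wk

/-- The stage after stage number `k`. -/
noncomputable def next (k : ℕ) (s : Stage) : Stage where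
  Γ := (s.Q k.unpair.1).1 :: s.Γ
  H := decideTask T s.H (s.Q k.unpair.1)
  Q i := if i.unpair.1 = k + 1 then taskEnum _ i.unpair.2
    else ⟨(s.Q i).1, (s.Q i).2.wkUnder _⟩

/-- The sequence of stages that starts with the hypothesis `φ`. -/
noncomputable def chain (φ : Fm []) : ℕ → Stage
  | 0 => ⟨[], [φ], fun i => taskEnum [] i.unpair.2⟩
  | k + 1 => (chain φ k).next T k

variable {T}

theorem decideTask_consistent {Γ : List Ty} {H : List (Fm Γ)} (hH : ¬ Prf T Γ H .bot)
    (q : Task Γ) : ¬ Prf T _ (decideTask T H q) .bot := by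
  unfold decideTask
  split_ifs with h
  · intro h'
    exact hH (.impE (.impI h) (.allI (.raa h')))
  · intro h'
    refine h ?_
    have := Prf.allE (σ := q.1) (φ := .bot) (dflt q.1)
      (.allI (H := .all q.1 q.2 :: H) h')
    exact this

theorem subset_decideTask {Γ : List Ty} (H : List (Fm Γ)) (q : Task Γ) :
    H.map Fm.wk ⊆ decideTask T H q := by
  unfold decideTask
  split_ifs <;> exact List.subset_cons_self _ _

theorem decideTask_henkin {Γ : List Ty} {H : List (Fm Γ)} (q : Task Γ) :
    ∀ {σ : Ty} {φ : Fm (σ :: Γ)}, q = ⟨σ, φ⟩ →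
      Prf T _ (decideTask T H q) (.all σ (φ.wkUnder q.1)) ∨
        ∃ t, Prf T _ (decideTask T H q) ((φ.wkUnder q.1).inst t).neg := by
  rintro σ φ rfl
  unfold decideTask
  split_ifs with h
  · right
    refine ⟨.var .z, .hyp ?_⟩
    rw [Fm.wkUnder_inst_z]
    exact List.mem_cons_self ..
  · exact .inl (.hyp (List.mem_cons_self ..))

theorem chain_Q (φ₀ : Fm []) {N j : ℕ} {σ : Ty} (φ : ∀ n, Fm (σ :: (chain T φ₀ n).Γ))
    (hφ : ∀ n, N ≤ n → φ (n + 1) = (φ n).wkUnder _)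
    (hj : taskEnum (chain T φ₀ N).Γ j = ⟨σ, φ N⟩) (n : ℕ) (hn : N ≤ n) :
    (chain T φ₀ n).Q (Nat.pair N j) = ⟨σ, φ n⟩ := by
  induction n, hn using Nat.le_induction with
  | base =>
    cases N with
    | zero => simpa [chain] using hj
    | succ N =>
      simp only [chain, next, Nat.unpair_pair, if_true]
      exact hj
  | succ n hn ih =>
    rw [hφ n hn]
    have h : N ≠ n + 1 := by omega
    simp only [chain, next, Nat.unpair_pair, h, if_false]
    rw [ih]

/-- The stages form a Henkin chain. -/
noncomputable def henkinChain {φ₀ : Fm []} (h0 : ¬ Prf T [] [φ₀] .bot) : HenkinChain T where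
  Γ n := (chain T φ₀ n).Γ
  H n := (chain T φ₀ n).H
  sh n := Sbst.shift _ _
  mono h := (h.wk _).mono (subset_decideTask _ _)
  consistent n := by
    induction n with
    | zero => exact h0
    | succ n ih => exact decideTask_consistent ih _
  henkin {σ} N φ hφ := by
    obtain ⟨j, hj⟩ := taskEnum_surjective _ ⟨σ, φ N⟩
    -- the task is taken up at the first step `n ≥ N` that deals with its place
    let n := Nat.pair (Nat.pair N j) N
    have hn : N ≤ n := Nat.right_le_pair _ _
    have hq : (chain T φ₀ n).Q n.unpair.1 = ⟨σ, φ n⟩ := by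
      simp only [n, Nat.unpair_pair]
      exact chain_Q φ₀ φ hφ hj _ hn
    have h1 := hφ n hn
    rcases decideTask_henkin (T := T) (H := (chain T φ₀ n).H) _ hq with h | ⟨t, h⟩
    · refine .inl ⟨n + 1, hn.trans n.le_succ, ?_⟩
      rw [h1]; exact h
    · refine .inr ⟨n + 1, hn.trans n.le_succ, t, ?_⟩
      rw [h1]; exact h

end Stage

/-- Gödel's completeness theorem: a closed formula which is true in all models of `T` is provable
from `T`. -/
theorem proves_of_forall_sat {T : Set (Fm [])} {φ : Fm []}
    (h : ∀ M : Str, (∀ ψ ∈ T, ψ.Sat (M := M) .nil) → φ.Sat (M := M) .nil) : Proves T φ := by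
  by_contra hφ
  have h0 : ¬ Prf T [] [φ.neg] .bot := fun h => hφ (.raa h)
  let C := Stage.henkinChain h0
  have hc : C.CohS fun n => Sbst.empty (C.Γ n) := .of_forall fun n => by
    funext σ x; cases x
  have hs (ψ : Fm []) : ψ.Sat (M := C.model) .nil ↔ C.Holds fun n => ψ.subst (Sbst.empty (C.Γ n)) := by
    rw [← C.sat_env ψ _ hc, Env.eq_nil (C.env _ hc)]
  have h1 := (hs φ).1 (h C.model fun ψ hψ => (hs ψ).2 (.of_forall fun n => .ax hψ))
  refine C.not_holds_and h1 (C.holds_of_prf (N := 0) (fun n _ => ?_) ?_)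
  · rw [Fm.neg, Fm.neg, Fm.subst, Fm.subst_subst]
    congr 2
    funext σ x; cases x
  · refine .hyp (List.mem_singleton.2 ?_)
    conv_rhs => rw [← Fm.subst_id φ.neg]
    change φ.neg.subst (Sbst.empty []) = _
    congr 1
    funext σ x; cases x


/-! ### Values of terms and truth of formulas -/

section Semantics

variable {M : Str} {Γ : List Ty}

instance {σ τ : Ty} : CoeFun (M.El (σ ⇒ τ)) fun _ => M.El σ → M.El τ := ⟨M.app⟩

instance : Zero (M.El .nat) := ⟨M.cst .zero⟩

/-- Successor in a structure. -/
def Str.suc (a : M.El .nat) : M.El .nat := M.cst .succ a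

/-- The empty sequence in a structure. -/
def Str.nil {σ : Ty} : M.El (.seq σ) := M.cst (.nil σ)

/-- Prefixing an element to a sequence in a structure. -/
def Str.cons {σ : Ty} (a : M.El σ) (w : M.El (.seq σ)) : M.El (.seq σ) := M.cst (.cons σ) a w

/-- The recursor in a structure. -/
def Str.recN {ρ : Ty} (a : M.El ρ) (f : M.El (ρ ⇒ .nat ⇒ ρ)) (n : M.El .nat) : M.El ρ :=
  M.cst (.R ρ) a f n

/-- The list recursor in a structure. -/
def Str.recL {σ ρ : Ty} (a : M.El ρ) (f : M.El (ρ ⇒ σ ⇒ ρ)) (w : M.El (.seq σ)) : M.El ρ :=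
  M.cst (.L σ ρ) a f w

open Str

@[simp] theorem Tm.eval_v0 {σ : Ty} (e : Env M Γ) (a : M.El σ) : v0.eval (e.ext a) = a := rfl
@[simp] theorem Tm.eval_v1 {σ τ : Ty} (e : Env M Γ) (a : M.El σ) (b : M.El τ) :
    v1.eval ((e.ext a).ext b) = a := rfl
@[simp] theorem Tm.eval_v2 {σ τ ρ : Ty} (e : Env M Γ) (a : M.El σ) (b : M.El τ) (c : M.El ρ) :
    v2.eval (((e.ext a).ext b).ext c) = a := rfl
@[simp] theorem Tm.eval_v3 {σ τ ρ π : Ty} (e : Env M Γ) (a : M.El σ) (b : M.El τ) (c : M.El ρ)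
    (d : M.El π) : v3.eval ((((e.ext a).ext b).ext c).ext d) = a := rfl
@[simp] theorem Tm.eval_var {σ : Ty} (e : Env M Γ) (x : Var Γ σ) : (Tm.var x).eval e = e _ x := rfl
@[simp] theorem Env.ext_z {σ : Ty} (e : Env M Γ) (a : M.El σ) : e.ext a _ .z = a := rfl
@[simp] theorem Env.ext_s {σ τ : Ty} (e : Env M Γ) (a : M.El σ) (x : Var Γ τ) :
    e.ext a _ (.s x) = e _ x := rfl
@[simp] theorem Tm.eval_app {σ τ : Ty} (e : Env M Γ) (f : Tm Γ (σ ⇒ τ)) (a : Tm Γ σ) :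
    (f ⬝ a).eval e = (f.eval e) (a.eval e) := rfl
@[simp] theorem Tm.eval_zero (e : Env M Γ) : zero.eval e = 0 := rfl
@[simp] theorem Tm.eval_succ (e : Env M Γ) (a : Tm Γ .nat) :
    (succ a).eval e = suc (a.eval e) := rfl
@[simp] theorem Tm.eval_nil {σ : Ty} (e : Env M Γ) :
    (NSA.nil : Tm Γ (.seq σ)).eval e = Str.nil := rfl
@[simp] theorem Tm.eval_cons {σ : Ty} (e : Env M Γ) (a : Tm Γ σ) (w : Tm Γ (.seq σ)) :
    (NSA.cons a w).eval e = Str.cons (a.eval e) (w.eval e) := rfl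
@[simp] theorem Tm.eval_recN {ρ : Ty} (e : Env M Γ) (a : Tm Γ ρ) (f : Tm Γ (ρ ⇒ .nat ⇒ ρ))
    (n : Tm Γ .nat) : (NSA.recN a f n).eval e = Str.recN (a.eval e) (f.eval e) (n.eval e) := rfl
@[simp] theorem Tm.eval_recL {σ ρ : Ty} (e : Env M Γ) (a : Tm Γ ρ) (f : Tm Γ (ρ ⇒ σ ⇒ ρ))
    (w : Tm Γ (.seq σ)) : (NSA.recL a f w).eval e = Str.recL (a.eval e) (f.eval e) (w.eval e) := rfl

theorem Tm.eval_subst {Δ : List Ty} (θ : Sbst Γ Δ) (e : Env M Δ) {σ : Ty} (t : Tm Γ σ) :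
    (t.subst θ).eval e = t.eval fun _ x => (θ _ x).eval e := by
  induction t with
  | var x => rfl
  | cst c => rfl
  | app a b iha ihb => rw [Tm.subst, Tm.eval, iha, ihb]; rfl

@[simp] theorem Tm.eval_wk {σ τ : Ty} (e : Env M Γ) (a : M.El τ) (t : Tm Γ σ) :
    t.wk.eval (e.ext a) = t.eval e := by
  rw [Tm.wk, Tm.eval_subst]; rfl

theorem Fm.sat_subst {Δ : List Ty} (θ : Sbst Γ Δ) (e : Env M Δ) (φ : Fm Γ) :
    (φ.subst θ).Sat e ↔ φ.Sat fun _ x => (θ _ x).eval e := by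
  induction φ generalizing Δ with
  | bot => rfl
  | imp φ ψ h1 h2 => exact imp_congr (h1 θ e) (h2 θ e)
  | eq a b => simp only [Fm.subst, Fm.Sat, Tm.eval_subst]
  | st a => simp only [Fm.subst, Fm.Sat, Tm.eval_subst]
  | all σ φ ih =>
    refine forall_congr' fun a => (ih (θ.up σ) (e.ext a)).trans ?_
    rw [Env.hext (e := fun _ x => (θ.up σ _ x).eval (e.ext a))
      (f := Env.ext (fun _ x => (θ _ x).eval e) a) rfl fun _ x => Tm.eval_wk e a (θ _ x)]

theorem Fm.sat_inst {σ : Ty} (e : Env M Γ) (φ : Fm (σ :: Γ)) (t : Tm Γ σ) :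
    (φ.inst t).Sat e ↔ φ.Sat (e.ext (t.eval e)) := by
  rw [Fm.inst, Fm.sat_subst]
  rw [Env.hext (e := fun _ x => ((Sbst.id Γ).ext t _ x).eval e) (f := e.ext (t.eval e)) rfl
    fun _ _ => rfl]

@[simp] theorem Fm.sat_imp (e : Env M Γ) (φ ψ : Fm Γ) :
    (Fm.imp φ ψ).Sat e ↔ (φ.Sat e → ψ.Sat e) := Iff.rfl
@[simp] theorem Fm.sat_eq {σ : Ty} (e : Env M Γ) (a b : Tm Γ σ) :
    (Fm.eq a b).Sat e ↔ a.eval e = b.eval e := Iff.rfl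
@[simp] theorem Fm.sat_st {σ : Ty} (e : Env M Γ) (a : Tm Γ σ) :
    (Fm.st a).Sat e ↔ M.st (a.eval e) := Iff.rfl
@[simp] theorem Fm.sat_all {σ : Ty} (e : Env M Γ) (φ : Fm (σ :: Γ)) :
    (Fm.all σ φ).Sat e ↔ ∀ a, φ.Sat (e.ext a) := Iff.rfl
@[simp] theorem Fm.sat_neg (e : Env M Γ) (φ : Fm Γ) : φ.neg.Sat e ↔ ¬ φ.Sat e := Iff.rfl
@[simp] theorem Fm.sat_and (e : Env M Γ) (φ ψ : Fm Γ) :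
    (Fm.and φ ψ).Sat e ↔ φ.Sat e ∧ ψ.Sat e := by simp [Fm.and]
@[simp] theorem Fm.sat_or (e : Env M Γ) (φ ψ : Fm Γ) :
    (Fm.or φ ψ).Sat e ↔ φ.Sat e ∨ ψ.Sat e := by simp [Fm.or, or_iff_not_imp_left]
@[simp] theorem Fm.sat_ex {σ : Ty} (e : Env M Γ) (φ : Fm (σ :: Γ)) :
    (Fm.ex σ φ).Sat e ↔ ∃ a, φ.Sat (e.ext a) := by simp [Fm.ex]
@[simp] theorem Fm.sat_allst {σ : Ty} (e : Env M Γ) (φ : Fm (σ :: Γ)) :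
    (Fm.allst σ φ).Sat e ↔ ∀ a, M.st a → φ.Sat (e.ext a) := Iff.rfl
@[simp] theorem Fm.sat_exst {σ : Ty} (e : Env M Γ) (φ : Fm (σ :: Γ)) :
    (Fm.exst σ φ).Sat e ↔ ∃ a, M.st a ∧ φ.Sat (e.ext a) := by simp [Fm.exst]

theorem Fm.sat_closure (φ : Fm Γ) :
    φ.closure.Sat (M := M) .nil ↔ ∀ e : Env M Γ, φ.Sat e := by
  induction Γ with
  | nil => exact ⟨fun h e => by rwa [Env.eq_nil e], fun h => h _⟩
  | cons σ Γ ih =>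
    refine (ih _).trans ⟨fun h e => ?_, fun h e a => h _⟩
    have := h (fun _ x => e _ (.s x)) (e _ .z)
    rwa [Env.hext (e := Env.ext (fun _ x => e _ (.s x)) (e _ .z)) (f := e) rfl
      fun _ _ => rfl] at this

end Semantics

/-! ### Models of `P` -/

/-- The structure `M` is a model of the system `P`. -/
class ModelsP (M : Str) : Prop where
  sat : ∀ ψ ∈ P, ψ.Sat (M := M) .nil

/-- A predicate on a structure that is definable by an internal formula with parameters. -/
def Str.IntPred {M : Str} {σ : Ty} (p : M.El σ → Prop) : Prop :=
  ∃ (Γ : List Ty) (φ : Fm (σ :: Γ)) (e : Env M Γ), φ.Internal ∧ ∀ x, φ.Sat (e.ext x) ↔ p x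

/-- A relation on a structure that is definable by an internal formula with parameters. -/
def Str.IntRel {M : Str} {σ τ : Ty} (r : M.El σ → M.El τ → Prop) : Prop :=
  ∃ (Γ : List Ty) (φ : Fm (τ :: σ :: Γ)) (e : Env M Γ),
    φ.Internal ∧ ∀ x y, φ.Sat ((e.ext x).ext y) ↔ r x y

namespace Str

theorem st_nil {M : Str} (σ : Ty) (x : Var [] σ) : M.st (Env.nil (M := M) σ x) := nomatch x

theorem st_ext {M : Str} {Γ : List Ty} {e : Env M Γ} (he : ∀ σ (x : Var Γ σ), M.st (e σ x)) {τ : Ty}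
    {a : M.El τ} (ha : M.st a) (σ : Ty) (x : Var (τ :: Γ) σ) : M.st (e.ext a σ x) := by
  cases x with
  | z => exact ha
  | s x => exact he _ x

variable {M : Str} [ModelsP M]

section Axioms

theorem arith {φ : Fm []} (h : EPA φ) : φ.Sat (M := M) .nil := ModelsP.sat _ (.arith h)

theorem suc_ne_zero (n : M.El .nat) : suc n ≠ 0 := arith .succNeZero n

theorem suc_inj {m n : M.El .nat} (h : suc m = suc n) : m = n := arith .succInj m n h

theorem app_ext {σ τ : Ty} {f g : M.El (σ ⇒ τ)} (h : ∀ a, f a = g a) : f = g :=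
  arith (.ext σ τ) f g h

theorem app_K {σ τ : Ty} (a : M.El σ) (b : M.El τ) : M.cst (.K σ τ) a b = a :=
  arith (.combK σ τ) a b

theorem app_S {ρ σ τ : Ty} (a : M.El (ρ ⇒ σ ⇒ τ)) (b : M.El (ρ ⇒ σ)) (c : M.El ρ) :
    M.cst (.S ρ σ τ) a b c = a c (b c) :=
  arith (.combS ρ σ τ) a b c

@[simp] theorem recN_zero {ρ : Ty} (a : M.El ρ) (f : M.El (ρ ⇒ .nat ⇒ ρ)) : recN a f 0 = a :=
  arith (.recZero ρ) a f

@[simp] theorem recN_suc {ρ : Ty} (a : M.El ρ) (f : M.El (ρ ⇒ .nat ⇒ ρ)) (n : M.El .nat) :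
    recN a f (suc n) = f (recN a f n) n :=
  arith (.recSucc ρ) a f n

@[simp] theorem recL_nil {σ ρ : Ty} (a : M.El ρ) (f : M.El (ρ ⇒ σ ⇒ ρ)) : recL a f nil = a :=
  arith (.recNil σ ρ) a f

@[simp] theorem recL_cons {σ ρ : Ty} (a : M.El ρ) (f : M.El (ρ ⇒ σ ⇒ ρ)) (x : M.El σ)
    (w : M.El (.seq σ)) : recL a f (cons x w) = f (recL a f w) x :=
  arith (.recCons σ ρ) a f x w

theorem seq_cases {σ : Ty} (w : M.El (.seq σ)) : w = nil ∨ ∃ a v, w = cons a v := by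
  have := arith (M := M) (.seqCases σ) w
  simpa using this

@[simp] theorem eval_lam {Γ : List Ty} {σ : Ty} (e : Env M Γ) : ∀ {τ : Ty} (t : Tm (σ :: Γ) τ)
    (a : M.El σ), (lam t).eval e a = t.eval (e.ext a)
  | _, .var .z, _ => (app_S _ _ _).trans (app_K _ _)
  | _, .var (.s _), _ => app_K _ _
  | _, .cst _, _ => app_K _ _
  | _, .app f b, a => (app_S _ _ _).trans
      (by rw [eval_lam e f a, eval_lam e b a]; rfl)

/-- Induction for internal predicates. -/
theorem nat_induction {p : M.El .nat → Prop} (hp : IntPred p) (h0 : p 0)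
    (hs : ∀ n, p n → p (suc n)) (n : M.El .nat) : p n := by
  obtain ⟨Γ, φ, e, hφ, h⟩ := hp
  have := (Fm.sat_closure _).1 (arith (M := M) (.induction φ hφ)) e
  simp only [Fm.sat_imp, Fm.sat_all, Fm.sat_inst, Tm.eval_zero, h] at this
  refine this h0 (fun a ha => ?_) n
  rw [Fm.sat_subst, Env.hext (e := fun _ x => Tm.eval (e.ext a) _) (f := e.ext (suc a)) rfl
    fun _ _ => rfl]
  exact (h _).2 (hs a ha)

/-- External induction. -/
theorem st_induction {p : M.El .nat → Prop} {Γ : List Ty} (φ : Fm (.nat :: Γ)) (e : Env M Γ)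
    (h : ∀ x, φ.Sat (e.ext x) ↔ p x) (h0 : p 0)
    (hs : ∀ n, M.st n → p n → p (suc n)) (n : M.El .nat) (hn : M.st n) : p n := by
  have := (Fm.sat_closure _).1 (ModelsP.sat (M := M) _ (.extInduction φ)) e
  simp only [Fm.sat_imp, Fm.sat_and, Fm.sat_allst, Fm.sat_inst, Tm.eval_zero, h] at this
  refine this ⟨h0, fun a hst ha => ?_⟩ n hn
  rw [Fm.sat_subst, Env.hext (e := fun _ x => Tm.eval (e.ext a) _) (f := e.ext (suc a)) rfl
    fun _ _ => rfl]
  exact (h _).2 (hs a hst ha)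

theorem st_app {σ τ : Ty} {f : M.El (σ ⇒ τ)} {a : M.El σ} (hf : M.st f) (ha : M.st a) :
    M.st (f a) := by
  have := ModelsP.sat (M := M) _ (.stApp σ τ) f a
  simp only [Fm.sat_imp, Fm.sat_and] at this
  exact this ⟨hf, ha⟩

/-- The value of a term at standard arguments is standard. -/
theorem st_eval {Γ : List Ty} {e : Env M Γ} (he : ∀ σ (x : Var Γ σ), M.st (e σ x)) {σ : Ty}
    (t : Tm Γ σ) : M.st (t.eval e) := by
  induction t with
  | var x => exact he _ x
  | cst c => exact ModelsP.sat (M := M) _ (.stClosed (.cst c))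
  | app a b ha hb => exact st_app ha hb

end Axioms

end Str


/-! ### Arithmetic and sequences in a model -/

namespace Fm

variable {Γ : List Ty}

@[simp] theorem internal_bot : (Fm.bot : Fm Γ).Internal := trivial
@[simp] theorem internal_eq {σ : Ty} (a b : Tm Γ σ) : (Fm.eq a b).Internal := trivial
@[simp] theorem internal_imp (φ ψ : Fm Γ) :
    (Fm.imp φ ψ).Internal ↔ φ.Internal ∧ ψ.Internal := Iff.rfl
@[simp] theorem internal_all {σ : Ty} (φ : Fm (σ :: Γ)) :
    (Fm.all σ φ).Internal ↔ φ.Internal := Iff.rfl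
@[simp] theorem internal_neg (φ : Fm Γ) : φ.neg.Internal ↔ φ.Internal := by simp [Fm.neg]
@[simp] theorem internal_and (φ ψ : Fm Γ) :
    (Fm.and φ ψ).Internal ↔ φ.Internal ∧ ψ.Internal := by simp [Fm.and]
@[simp] theorem internal_or (φ ψ : Fm Γ) :
    (Fm.or φ ψ).Internal ↔ φ.Internal ∧ ψ.Internal := by simp [Fm.or]
@[simp] theorem internal_ex {σ : Ty} (φ : Fm (σ :: Γ)) :
    (Fm.ex σ φ).Internal ↔ φ.Internal := by simp [Fm.ex]
@[simp] theorem internal_le (a b : Tm Γ .nat) : (le a b).Internal := trivial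
@[simp] theorem internal_lt (a b : Tm Γ .nat) : (lt a b).Internal := trivial
@[simp] theorem internal_mem {σ : Ty} (a : Tm Γ σ) (w : Tm Γ (.seq σ)) :
    (mem a w).Internal := by simp [mem]
@[simp] theorem internal_agree (f g : Tm Γ .one) (N : Tm Γ .nat) :
    (agree f g N).Internal := by simp [agree]
@[simp] theorem internal_cont (Y : Tm Γ .two) : (cont Y).Internal := by simp [cont]

theorem internal_subst {Δ : List Ty} (θ : Sbst Γ Δ) (φ : Fm Γ) (h : φ.Internal) :
    (φ.subst θ).Internal := by
  induction φ generalizing Δ with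
  | bot => trivial
  | imp φ ψ h1 h2 => exact ⟨h1 θ h.1, h2 θ h.2⟩
  | eq a b => trivial
  | st a => exact h
  | all σ φ ih => exact ih _ h

end Fm

namespace Str

variable {M : Str}

/-- Predecessor in a structure. -/
def pred (a : M.El .nat) : M.El .nat := recN 0 ((lam (lam v0)).eval .nil) a

/-- Truncated subtraction in a structure. -/
def monus (a b : M.El .nat) : M.El .nat := recN a ((lam (lam (NSA.pred v1))).eval .nil) b

/-- The length of a sequence in a structure. -/
def len {σ : Ty} (w : M.El (.seq σ)) : M.El .nat := recL 0 ((lam (lam (succ v1))).eval .nil) w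

/-- Appending an element to a sequence in a structure. -/
def snoc {σ : Ty} (w : M.El (.seq σ)) (a : M.El σ) : M.El (.seq σ) :=
  recL (cons a nil) ((lam (lam (NSA.cons v0 v1))).eval .nil) w

/-- The infinite sequence that starts with the finite sequence `w` and continues with `f`. -/
def cat {σ : Ty} (w : M.El (.seq σ)) (f : M.El (.nat ⇒ σ)) : M.El (.nat ⇒ σ) :=
  recL f ((lam (lam (lam (NSA.recN v1
    (lam (lam (.app (.var (.s (.s (.s (.s .z))))) v0))) v0)))).eval .nil) w

/-- An element of a sequence in a structure. -/
def nth {σ : Ty} (w : M.El (.seq σ)) (i : M.El .nat) : M.El σ :=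
  cat w ((dflt (.nat ⇒ σ)).eval .nil) i

variable {Γ : List Ty}

@[simp] theorem eval_pred (e : Env M Γ) (a : Tm Γ .nat) :
    (NSA.pred a).eval e = pred (a.eval e) := rfl

@[simp] theorem eval_monus (e : Env M Γ) (a b : Tm Γ .nat) :
    (NSA.monus a b).eval e = monus (a.eval e) (b.eval e) := rfl

@[simp] theorem eval_len {σ : Ty} (e : Env M Γ) (w : Tm Γ (.seq σ)) :
    (NSA.len w).eval e = len (w.eval e) := rfl

@[simp] theorem eval_snoc {σ : Ty} (e : Env M Γ) (w : Tm Γ (.seq σ)) (a : Tm Γ σ) :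
    (NSA.snoc w a).eval e = snoc (w.eval e) (a.eval e) := rfl

@[simp] theorem eval_cat {σ : Ty} (e : Env M Γ) (w : Tm Γ (.seq σ)) (a : Tm Γ (.nat ⇒ σ)) :
    (NSA.cat w a).eval e = cat (w.eval e) (a.eval e) := rfl

@[simp] theorem eval_dflt (e : Env M Γ) : ∀ σ : Ty,
    (dflt σ).eval e = (dflt σ).eval (Γ := []) .nil
  | .nat => rfl
  | .arr σ τ => by rw [dflt, dflt, Tm.eval_app, Tm.eval_app, eval_dflt e τ]; rfl
  | .seq _ => rfl

instance : LE (M.El .nat) := ⟨fun a b => monus a b = 0⟩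

theorem le_def {a b : M.El .nat} : a ≤ b ↔ monus a b = 0 := Iff.rfl

@[simp] theorem _root_.NSA.Fm.sat_le (e : Env M Γ) (a b : Tm Γ .nat) :
    (NSA.le a b).Sat e ↔ a.eval e ≤ b.eval e := by simp [NSA.le, le_def]

@[simp] theorem eval_nth {σ : Ty} (e : Env M Γ) (w : Tm Γ (.seq σ)) (i : Tm Γ .nat) :
    (NSA.nth w i).eval e = nth (w.eval e) (i.eval e) := by
  rw [NSA.nth, nth, Tm.eval_app, eval_cat, eval_dflt]

variable [ModelsP M]

theorem zero_or_suc (n : M.El .nat) : n = 0 ∨ ∃ m, n = suc m := by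
  refine nat_induction (p := fun n => n = 0 ∨ ∃ m, n = suc m)
    ⟨[], .or (.eq v0 zero) (.ex .nat (.eq v1 (succ v0))), .nil, by simp, fun x => by simp⟩
    (.inl rfl) (fun n _ => .inr ⟨n, rfl⟩) n

@[simp] theorem pred_zero : pred (0 : M.El .nat) = 0 := by simp [pred]
@[simp] theorem pred_suc (n : M.El .nat) : pred (suc n) = n := by simp [pred]

@[simp] theorem monus_zero (n : M.El .nat) : monus n 0 = n := by simp [monus]
theorem monus_suc (m n : M.El .nat) : monus m (suc n) = pred (monus m n) := by simp [monus]

@[simp] theorem monus_suc_suc (m n : M.El .nat) : monus (suc m) (suc n) = monus m n := by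
  refine nat_induction (p := fun n => monus (suc m) (suc n) = monus m n)
    ⟨[.nat], .eq (NSA.monus (succ v1) (succ v0)) (NSA.monus v1 v0), Env.nil.ext m, by simp,
      fun x => by simp⟩ (by simp [monus_suc]) (fun n h => ?_) n
  rw [monus_suc, h, monus_suc]

@[simp] theorem zero_monus (n : M.El .nat) : monus 0 n = 0 := by
  refine nat_induction (p := fun n => monus 0 n = 0)
    ⟨[], .eq (NSA.monus zero v0) zero, Env.nil, by simp,
      fun x => by simp⟩ (by simp) (fun n h => ?_) n
  rw [monus_suc, h, pred_zero]

@[simp] theorem nat_zero_le (a : M.El .nat) : 0 ≤ a := zero_monus a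
@[simp] theorem suc_le_suc {a b : M.El .nat} : suc a ≤ suc b ↔ a ≤ b := by simp [le_def]
@[simp] theorem not_suc_le_zero (a : M.El .nat) : ¬ suc a ≤ 0 := by simp [le_def, suc_ne_zero]

theorem nat_le_refl (a : M.El .nat) : a ≤ a := by
  refine nat_induction (p := fun n => n ≤ n) ⟨[], le v0 v0, .nil, by simp, fun x => by simp⟩
    (by simp) (fun n h => by simpa) a

theorem nat_le_antisymm {a b : M.El .nat} : a ≤ b → b ≤ a → a = b := by
  refine nat_induction (p := fun a => ∀ b, a ≤ b → b ≤ a → a = b)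
    ⟨[], .all .nat (.imp (le v1 v0) (.imp (le v0 v1) (.eq v1 v0))), .nil, by simp,
      fun x => by simp⟩ (fun b h1 h2 => ?_) (fun a h b h1 h2 => ?_) a b
  · rcases zero_or_suc b with rfl | ⟨b, rfl⟩
    · rfl
    · simp at h2
  · rcases zero_or_suc b with rfl | ⟨b, rfl⟩
    · simp at h1
    · rw [h b (by simpa using h1) (by simpa using h2)]

theorem nat_le_trans {a b c : M.El .nat} : a ≤ b → b ≤ c → a ≤ c := by
  refine nat_induction (p := fun a => ∀ b c, a ≤ b → b ≤ c → a ≤ c)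
    ⟨[], .all .nat (.all .nat (.imp (le v2 v1) (.imp (le v1 v0) (le v2 v0)))), .nil, by simp,
      fun x => by simp⟩ (fun b c h1 h2 => by simp) (fun a h b c h1 h2 => ?_) a b c
  rcases zero_or_suc b with rfl | ⟨b, rfl⟩
  · simp at h1
  rcases zero_or_suc c with rfl | ⟨c, rfl⟩
  · simp at h2
  · rw [suc_le_suc] at *
    exact h b c h1 h2

theorem nat_le_total (a b : M.El .nat) : a ≤ b ∨ b ≤ a := by
  refine nat_induction (p := fun a => ∀ b, a ≤ b ∨ b ≤ a)
    ⟨[], .all .nat (.or (le v1 v0) (le v0 v1)), .nil, by simp,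
      fun x => by simp⟩ (fun b => by simp) (fun a h b => ?_) a b
  rcases zero_or_suc b with rfl | ⟨b, rfl⟩
  · simp
  · simpa using h b

/-- The numbers of a model are linearly ordered. -/
noncomputable instance : LinearOrder (M.El .nat) where
  le_refl := nat_le_refl
  le_trans _ _ _ := nat_le_trans
  le_antisymm _ _ := nat_le_antisymm
  le_total := nat_le_total
  toDecidableLE := Classical.decRel _

@[simp] theorem le_zero {a : M.El .nat} : a ≤ 0 ↔ a = 0 :=
  ⟨fun h => le_antisymm h (nat_zero_le a), fun h => h.le⟩

theorem not_suc_le_self (a : M.El .nat) : ¬ suc a ≤ a := by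
  refine nat_induction (p := fun n => ¬ suc n ≤ n)
    ⟨[], .neg (le (succ v0) v0), .nil, by simp, fun x => by simp⟩ ?_ (fun n h => ?_) a
  · exact not_suc_le_zero 0
  · exact fun h' => h (suc_le_suc.1 h')

theorem le_suc (a : M.El .nat) : a ≤ suc a := by
  refine nat_induction (p := fun n => n ≤ suc n)
    ⟨[], le v0 (succ v0), .nil, by simp, fun x => by simp⟩ (by simp) (fun n h => by simpa) a

theorem suc_le_iff {a b : M.El .nat} : suc a ≤ b ↔ a < b := by
  refine ⟨fun h => lt_of_le_of_ne ((le_suc a).trans h) ?_, ?_⟩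
  · rintro rfl
    exact not_suc_le_self _ h
  · refine nat_induction (p := fun a => ∀ b, ¬ b ≤ a → suc a ≤ b)
      ⟨[], .all .nat (.imp (.neg (le v0 v1)) (le (succ v1) v0)), .nil, by simp,
        fun x => by simp⟩ (fun b h => ?_) (fun a h b hb => ?_) a b ∘ not_le_of_gt
    · rcases zero_or_suc b with rfl | ⟨b, rfl⟩
      · simp at h
      · simp
    · rcases zero_or_suc b with rfl | ⟨b, rfl⟩
      · simp at hb
      · rw [suc_le_suc] at *
        exact h b hb

@[simp] theorem lt_suc_iff {a b : M.El .nat} : a < suc b ↔ a ≤ b := by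
  rw [← suc_le_iff, suc_le_suc]

theorem le_suc_iff {a b : M.El .nat} : a ≤ suc b ↔ a ≤ b ∨ a = suc b := by
  rw [le_iff_lt_or_eq, lt_suc_iff]

theorem lt_suc_self (a : M.El .nat) : a < suc a := by simp

theorem ne_zero_of_lt {a b : M.El .nat} (h : a < b) : b ≠ 0 := by
  rintro rfl
  exact h.not_ge (nat_zero_le a)

@[simp] theorem _root_.NSA.Fm.sat_lt (e : Env M Γ) (a b : Tm Γ .nat) :
    (NSA.lt a b).Sat e ↔ a.eval e < b.eval e := by simp [NSA.lt, suc_le_iff]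

@[simp] theorem eval_ifZero {σ : Ty} (e : Env M Γ) (c : Tm Γ .nat) (a b : Tm Γ σ) :
    (ifZero c a b).eval e = if c.eval e = 0 then a.eval e else b.eval e := by
  rw [ifZero, Tm.eval_recN]
  rcases zero_or_suc (c.eval e) with h | ⟨m, h⟩
  · simp [h]
  · simp [h, suc_ne_zero]

@[simp] theorem len_nil {σ : Ty} : len (nil : M.El (.seq σ)) = 0 := by simp [len]
@[simp] theorem len_cons {σ : Ty} (a : M.El σ) (w : M.El (.seq σ)) :
    len (cons a w) = suc (len w) := by simp [len]

@[simp] theorem snoc_nil {σ : Ty} (a : M.El σ) : snoc nil a = cons a nil := by simp [snoc]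
@[simp] theorem snoc_cons {σ : Ty} (a b : M.El σ) (w : M.El (.seq σ)) :
    snoc (cons a w) b = cons a (snoc w b) := by simp [snoc]

@[simp] theorem cat_nil {σ : Ty} (f : M.El (.nat ⇒ σ)) : cat nil f = f := by simp [cat]
@[simp] theorem cat_cons_zero {σ : Ty} (a : M.El σ) (w : M.El (.seq σ)) (f : M.El (.nat ⇒ σ)) :
    cat (cons a w) f 0 = a := by simp [cat]
@[simp] theorem cat_cons_suc {σ : Ty} (a : M.El σ) (w : M.El (.seq σ)) (f : M.El (.nat ⇒ σ))
    (n : M.El .nat) : cat (cons a w) f (suc n) = cat w f n := by simp [cat]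

@[simp] theorem nth_cons_zero {σ : Ty} (a : M.El σ) (w : M.El (.seq σ)) :
    nth (cons a w) 0 = a := by simp [nth]
@[simp] theorem nth_cons_suc {σ : Ty} (a : M.El σ) (w : M.El (.seq σ)) (n : M.El .nat) :
    nth (cons a w) (suc n) = nth w n := by simp [nth]

/-- Induction on finite sequences, for internal predicates. -/
theorem seq_induction {σ : Ty} {p : M.El (.seq σ) → Prop} (hp : IntPred p) (h0 : p nil)
    (hs : ∀ a w, p w → p (cons a w)) (w : M.El (.seq σ)) : p w := by
  refine nat_induction (p := fun n => ∀ w, len w = n → p w) ?_ ?_ ?_ (len w) w rfl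
  · obtain ⟨Γ, φ, e, hφ, h⟩ := hp
    refine ⟨Γ, .all (.seq σ) (.imp (.eq (NSA.len v0) v1) (φ.subst ((Sbst.id Γ).wk.wk.ext v0))), e,
      by simpa using Fm.internal_subst _ φ hφ, fun n => ?_⟩
    simp only [Fm.sat_all, Fm.sat_imp, Fm.sat_eq, eval_len, Tm.eval_v0, Tm.eval_v1]
    refine forall_congr' fun w => imp_congr_right fun _ => ?_
    rw [← h, Fm.sat_subst, Env.hext (e := fun _ x => Tm.eval ((e.ext n).ext w) _) (f := e.ext w)
      rfl fun _ _ => rfl]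
  · intro w hw
    rcases seq_cases w with rfl | ⟨a, v, rfl⟩
    · exact h0
    · rw [len_cons] at hw
      exact absurd hw (suc_ne_zero _)
  · intro n ih w hw
    rcases seq_cases w with rfl | ⟨a, v, rfl⟩
    · exact h0
    · rw [len_cons] at hw
      exact hs a v (ih v (suc_inj hw))

@[simp] theorem len_snoc {σ : Ty} (w : M.El (.seq σ)) (a : M.El σ) :
    len (snoc w a) = suc (len w) := by
  refine seq_induction (p := fun w => len (snoc w a) = suc (len w))
    ⟨[σ], .eq (NSA.len (NSA.snoc v0 v1)) (succ (NSA.len v0)), Env.nil.ext a, by simp,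
      fun x => by simp⟩ (by simp) (fun x w h => by simp [h]) w

/-- Functions on numbers are equal if they agree at `0` and at successors. -/
theorem seq_ext {σ : Ty} {f g : M.El (.nat ⇒ σ)} (h0 : f 0 = g 0)
    (hs : ∀ n, f (suc n) = g (suc n)) : f = g :=
  app_ext fun n => by
    rcases zero_or_suc n with rfl | ⟨n, rfl⟩
    · exact h0
    · exact hs n

theorem cat_snoc {σ : Ty} (w : M.El (.seq σ)) (x : M.El σ) (a : M.El (.nat ⇒ σ)) :
    cat (snoc w x) a = cat w (cat (cons x nil) a) := by
  refine seq_induction (p := fun w => cat (snoc w x) a = cat w (cat (cons x nil) a))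
    ⟨[.nat ⇒ σ, σ], .eq (NSA.cat (NSA.snoc v0 v2) v1)
      (NSA.cat v0 (NSA.cat (NSA.cons v2 NSA.nil) v1)), (Env.nil.ext x).ext a, by simp,
      fun x => by simp⟩ (by simp) (fun y w h => ?_) w
  refine seq_ext (by simp) fun n => ?_
  simp [h]

theorem cat_of_lt {σ : Ty} {w : M.El (.seq σ)} {i : M.El .nat} (hi : i < len w)
    (a b : M.El (.nat ⇒ σ)) : cat w a i = cat w b i := by
  refine seq_induction (p := fun w => ∀ i, i < len w → cat w a i = cat w b i)
    ⟨[.nat ⇒ σ, .nat ⇒ σ], .all .nat (.imp (lt v0 (NSA.len v1))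
      (.eq (NSA.cat v1 v2 ⬝ v0) (NSA.cat v1 v3 ⬝ v0))), (Env.nil.ext b).ext a, by simp,
      fun x => by simp⟩ (fun i h => ?_) (fun x w h i hi => ?_) w i hi
  · exact absurd (len_nil (M := M)) (ne_zero_of_lt h)
  · rcases zero_or_suc i with rfl | ⟨i, rfl⟩
    · simp
    · simp only [cat_cons_suc]
      refine h i ?_
      rwa [len_cons, lt_suc_iff, suc_le_iff] at hi

theorem cat_congr {σ : Ty} (w : M.El (.seq σ)) {i : M.El .nat} {a b : M.El (.nat ⇒ σ)}
    (h : ∀ m, m ≤ i → a m = b m) : cat w a i = cat w b i := by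
  refine seq_induction
    (p := fun w => ∀ i, (∀ m, m ≤ i → a m = b m) → cat w a i = cat w b i)
    ⟨[.nat ⇒ σ, .nat ⇒ σ], .all .nat (.imp (.all .nat (.imp (le v0 v1) (.eq
      (.var (.s (.s (.s .z))) ⬝ v0) (.var (.s (.s (.s (.s .z)))) ⬝ v0))))
      (.eq (NSA.cat v1 v2 ⬝ v0) (NSA.cat v1 v3 ⬝ v0))), (Env.nil.ext b).ext a, by simp,
      fun x => by simp⟩ (fun i h => ?_) (fun x w h i hi => ?_) w i h
  · simpa using h i le_rfl
  · rcases zero_or_suc i with rfl | ⟨i, rfl⟩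
    · simp
    · simp only [cat_cons_suc]
      exact h i fun m hm => hi m (hm.trans (le_suc i))

/-- Membership in a finite sequence. -/
def Mem {σ : Ty} (x : M.El σ) (w : M.El (.seq σ)) : Prop := ∃ i, i < len w ∧ nth w i = x

@[simp] theorem _root_.NSA.Fm.sat_mem {σ : Ty} (e : Env M Γ) (a : Tm Γ σ) (w : Tm Γ (.seq σ)) :
    (mem a w).Sat e ↔ Mem (a.eval e) (w.eval e) := by simp [mem, Mem]

theorem not_mem_nil {σ : Ty} (x : M.El σ) : ¬ Mem x nil := by
  rintro ⟨i, hi, -⟩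
  exact absurd (len_nil (M := M)) (ne_zero_of_lt hi)

theorem mem_cons {σ : Ty} {x y : M.El σ} {w : M.El (.seq σ)} (h : Mem x (cons y w)) :
    x = y ∨ Mem x w := by
  obtain ⟨i, hi, rfl⟩ := h
  rcases zero_or_suc i with rfl | ⟨i, rfl⟩
  · simp
  · rw [len_cons, lt_suc_iff, suc_le_iff] at hi
    exact .inr ⟨i, hi, by simp⟩

end Str

namespace Str

variable {M : Str}

/-! ### Continuity and nonstandard continuity -/

@[simp] theorem _root_.NSA.Fm.sat_agree {Γ : List Ty} (e : Env M Γ) (f g : Tm Γ .one)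
    (N : Tm Γ .nat) :
    (agree f g N).Sat e ↔ ∀ i, i ≤ N.eval e → f.eval e i = g.eval e i := by
  simp [agree]

/-- Continuity of a functional of type two. -/
def Cont (Y : M.El .two) : Prop :=
  ∀ f : M.El .one, ∃ N, ∀ g : M.El .one, (∀ i, i ≤ N → g i = f i) → Y f = Y g

@[simp] theorem _root_.NSA.Fm.sat_cont {Γ : List Ty} (e : Env M Γ) (Y : Tm Γ .two) :
    (cont Y).Sat e ↔ Cont (Y.eval e) := by
  simp [cont, Cont]

/-- The axiom of nonstandard pointwise continuity holds in the model. -/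
def HasNPC (M : Str) : Prop :=
  ∀ Y : M.El .two, M.st Y → Cont Y → ∀ f : M.El .one, M.st f → ∀ g : M.El .one,
    (∀ n, M.st n → f n = g n) → Y f = Y g

theorem hasNPC_iff : NPC.Sat (M := M) .nil ↔ HasNPC M := by
  simp [NPC, HasNPC, approx]

/-- The standard part principle holds in the model. -/
def HasSTP (M : Str) : Prop :=
  ∀ f : M.El .one, (∀ n, f n ≤ suc 0) → ∃ g : M.El .one, M.st g ∧ ∀ n, M.st n → f n = g n

theorem hasSTP_of_sat (h : STP.Sat (M := M) .nil) : HasSTP M := by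
  simp only [STP, binary, approx, Fm.sat_all, Fm.sat_imp, Fm.sat_le, Fm.sat_exst, Fm.sat_and,
    Fm.sat_allst, Fm.sat_eq, Tm.eval_app, Tm.eval_wk, Tm.eval_v0, Tm.eval_v1, Tm.eval_succ,
    Tm.eval_zero] at h
  intro f hf
  obtain ⟨g, hg, -, h1⟩ := h f hf
  exact ⟨g, hg, h1⟩

variable [ModelsP M]

/-! ### Standard and nonstandard numbers -/

theorem st_zero : M.st (0 : M.El .nat) := st_eval st_nil zero

theorem st_suc {n : M.El .nat} (h : M.st n) : M.st (suc n) :=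
  st_eval (st_ext st_nil h) (succ v0)

theorem st_of_le {m n : M.El .nat} (h : m ≤ n) (hn : M.st n) : M.st m := by
  refine st_induction (p := fun n => ∀ m, m ≤ n → M.st m)
    (.all .nat (.imp (le v0 v1) (.st v0))) .nil (fun x => by simp) (fun m h => ?_)
    (fun n hn ih m h => ?_) n hn m h
  · rw [le_zero.1 h]
    exact st_zero
  · rcases le_suc_iff.1 h with h | rfl
    · exact ih m h
    · exact st_suc hn

theorem le_of_st_of_not_st {m n : M.El .nat} (hm : M.st m) (hn : ¬ M.st n) : m ≤ n :=
  le_of_not_ge fun h => hn (st_of_le h hm)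

/-- The Herbrandised axiom of choice, for internal relations. -/
theorem hac {σ τ : Ty} {r : M.El σ → M.El τ → Prop} (hr : IntRel r)
    (h : ∀ x, M.st x → ∃ y, M.st y ∧ r x y) :
    ∃ F : M.El (σ ⇒ .seq τ), M.st F ∧ ∀ x, M.st x → ∃ y, Mem y (F x) ∧ r x y := by
  obtain ⟨Γ, φ, e, hφ, hr⟩ := hr
  have := (Fm.sat_closure _).1 (ModelsP.sat (M := M) _ (.hac σ τ φ hφ)) e
  simp only [Fm.sat_imp, Fm.sat_allst, Fm.sat_exst, Fm.sat_ex, Fm.sat_and, Fm.sat_mem, hr,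
    Tm.eval_v0, Tm.eval_app, Tm.eval_v1, Tm.eval_v2] at this
  obtain ⟨F, hF, h1⟩ := this h
  refine ⟨F, hF, fun x hx => ?_⟩
  obtain ⟨y, hy, h2⟩ := h1 x hx
  refine ⟨y, hy, (hr x y).1 ?_⟩
  rw [Fm.sat_subst] at h2
  rwa [Env.hext (e := fun _ x_1 => Tm.eval (((e.ext F).ext x).ext y) _) (f := (e.ext x).ext y)
    rfl fun _ v => by cases v <;> rfl] at h2

/-- Idealisation, for internal relations. -/
theorem idealisation {σ τ : Ty} {r : M.El σ → M.El τ → Prop} (hr : IntRel r)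
    (h : ∀ w : M.El (.seq σ), M.st w → ∃ y, ∀ x, Mem x w → r x y) :
    ∃ y, ∀ x, M.st x → r x y := by
  obtain ⟨Γ, φ, e, hφ, hr⟩ := hr
  have := (Fm.sat_closure _).1 (ModelsP.sat (M := M) _ (.idealisation σ τ φ hφ)) e
  simp only [Fm.sat_imp, Fm.sat_allst, Fm.sat_ex, Fm.sat_all, Fm.sat_mem,
    Tm.eval_v0, Tm.eval_v2, Fm.sat_subst] at this
  have h1 (w : M.El (.seq σ)) (x : M.El σ) (y : M.El τ) :
      (fun _ v => Tm.eval (((e.ext w).ext y).ext x)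
        ((((Sbst.id Γ).wk.wk.wk.ext v0).ext v1) _ v) : Env M (τ :: σ :: Γ)) =
      (e.ext x).ext y := Env.hext rfl fun _ v => by cases v <;> rfl
  have h2 (x : M.El σ) (y : M.El τ) :
      (fun _ v => Tm.eval ((e.ext y).ext x)
        ((((Sbst.id Γ).wk.wk.ext v0).ext v1) _ v) : Env M (τ :: σ :: Γ)) =
      (e.ext x).ext y := Env.hext rfl fun _ v => by cases v <;> rfl
  simp only [h1, h2, hr] at this
  exact this h

/-- The greatest element of a finite sequence of numbers (`0` for the empty sequence), as a
term. -/
def maxT {Γ : List Ty} (w : Tm Γ (.seq .nat)) : Tm Γ .nat :=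
  NSA.recL zero (lam (lam (ifZero (NSA.monus v1 v0) v0 v1))) w

theorem le_maxT {Γ : List Ty} (e : Env M Γ) (t : Tm Γ (.seq .nat)) (x : M.El .nat)
    (h : Mem x (t.eval e)) : x ≤ (maxT t).eval e := by
  refine seq_induction (p := fun w => ∀ x, Mem x w → x ≤
      recL 0 ((lam (lam (ifZero (NSA.monus v1 v0) v0 v1))).eval Env.nil) w)
    ⟨[], .all .nat (.imp (mem v0 v1) (le v0 (maxT v1))), .nil, by simp, fun x => ?_⟩
    (fun x h => absurd h (not_mem_nil x)) (fun y w ih x hx => ?_) (t.eval e) x h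
  · simp only [Fm.sat_all, Fm.sat_imp, Fm.sat_mem, Fm.sat_le, Tm.eval_v0, Tm.eval_v1, maxT,
      Tm.eval_recL]
    rfl
  · simp only [recL_cons, eval_lam, eval_ifZero, eval_monus, Tm.eval_v0, Tm.eval_v1, ← le_def]
    rcases mem_cons hx with rfl | hx
    · split_ifs with h
      · exact le_rfl
      · exact (not_le.1 h).le
    · split_ifs with h
      · exact (ih x hx).trans h
      · exact ih x hx

/-- There is a nonstandard number. -/
theorem exists_not_st : ∃ n : M.El .nat, ¬ M.st n := by
  obtain ⟨n, hn⟩ := idealisation (M := M) (σ := .nat) (τ := .nat) (r := fun x y => x < y)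
    ⟨[], lt v1 v0, .nil, by simp, fun x y => by simp⟩
    fun w _ => ⟨suc ((maxT v0).eval (Env.nil.ext w)), fun x hx =>
      lt_suc_iff.2 (le_maxT (Env.nil.ext w) v0 x hx)⟩
  exact ⟨n, fun h => lt_irrefl _ (hn n h)⟩

/-- Underspill: an internal predicate that holds for all nonstandard numbers holds for some
standard number. -/
theorem underspill {p : M.El .nat → Prop} (hp : IntPred p) (h : ∀ n, ¬ M.st n → p n) :
    ∃ n, M.st n ∧ p n := by
  by_contra! hc
  obtain ⟨N, hN⟩ := exists_not_st (M := M)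
  -- otherwise `∀ m ≤ n, ¬ p m` would define the standard numbers
  refine nat_induction (p := fun n => ∀ m, m ≤ n → ¬ p m) ?_ (fun m hm => ?_)
    (fun n ih m hm => ?_) N N le_rfl (h N hN)
  · obtain ⟨Γ, φ, e, hφ, hp⟩ := hp
    refine ⟨Γ, .all .nat (.imp (le v0 v1) (.neg (φ.subst ((Sbst.id Γ).wk.wk.ext v0)))), e,
      by simpa using Fm.internal_subst _ φ hφ, fun n => ?_⟩
    simp only [Fm.sat_all, Fm.sat_imp, Fm.sat_le, Fm.sat_neg, Tm.eval_v0, Tm.eval_v1]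
    refine forall_congr' fun w => imp_congr_right fun _ => ?_
    rw [← hp, Fm.sat_subst, Env.hext (e := fun _ x => Tm.eval ((e.ext n).ext w) _) (f := e.ext w)
      rfl fun _ _ => rfl]
  · rw [le_zero.1 hm]
    exact hc 0 st_zero
  · have hn : M.st n := by
      by_contra hn
      exact ih n le_rfl (h n hn)
    exact hc m (st_of_le hm (st_suc hn))

/-- A standard continuous functional has a standard modulus of continuity at each standard
function. -/
theorem HasNPC.exists_modulus (hM : HasNPC M) {Y : M.El .two} (hY : M.st Y) (hc : Cont Y)
    {f : M.El .one} (hf : M.st f) :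
    ∃ N, M.st N ∧ ∀ g : M.El .one, (∀ i, i ≤ N → f i = g i) → Y f = Y g := by
  refine underspill (p := fun N => ∀ g : M.El .one, (∀ i, i ≤ N → f i = g i) → Y f = Y g)
    ⟨[.one, .two], .all .one (.imp (agree v2 v0 v1) (.eq (v3 ⬝ v2) (v3 ⬝ v0))),
      (Env.nil.ext Y).ext f, by simp, fun x => by simp⟩ fun N hN g hg => ?_
  exact hM Y hY hc f hf g fun n hn => hg n (le_of_st_of_not_st hn hN)

end Str

namespace Str

/-! ### From nonstandard continuity to transfer and unbounded search -/

variable {M : Str}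

/-- The first nonzero value among `h 0, …, h (n - 1)`, and `0` if there is none, as a term. -/
def firstT {Γ : List Ty} (h : Tm Γ .one) (n : Tm Γ .nat) : Tm Γ .nat :=
  NSA.recN zero (lam (lam (ifZero v1 (h.wk.wk ⬝ v0) v1))) n

/-- The first nonzero value among `h 0, …, h (n - 1)`, and `0` if there is none. -/
def first (h : M.El .one) (n : M.El .nat) : M.El .nat := (firstT v1 v0).eval ((Env.nil.ext h).ext n)

/-- The last entry `x` of a sequence with `h x ≠ 0`, as a term. -/
def pickT {Γ : List Ty} (h : Tm Γ .one) (w : Tm Γ (.seq .nat)) : Tm Γ .nat :=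
  NSA.recL zero (lam (lam (ifZero (h.wk.wk ⬝ v0) v1 v0))) w

variable [ModelsP M]

@[simp] theorem eval_firstT {Γ : List Ty} (e : Env M Γ) (h : Tm Γ .one) (n : Tm Γ .nat) :
    (firstT h n).eval e = first (h.eval e) (n.eval e) := by
  simp only [first, firstT, Tm.eval_recN, Tm.eval_zero, Tm.eval_v0]
  congr 1
  exact app_ext fun a => app_ext fun b => by simp

@[simp] theorem first_zero (h : M.El .one) : first h 0 = 0 := by simp [first, firstT]

theorem first_suc (h : M.El .one) (n : M.El .nat) :
    first h (suc n) = if first h n = 0 then h n else first h n := by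
  simp [first, firstT]
  rfl

theorem first_eq_zero {h : M.El .one} {n : M.El .nat} :
    first h n = 0 ↔ ∀ i, i < n → h i = 0 := by
  constructor
  · refine nat_induction (p := fun n => first h n = 0 → ∀ i, i < n → h i = 0)
      ⟨[.one], .imp (.eq (firstT v1 v0) zero) (.all .nat (.imp (lt v0 v1) (.eq (v2 ⬝ v0) zero))),
        Env.nil.ext h, by simp, fun x => by simp⟩
      (fun _ i hi => absurd rfl (ne_zero_of_lt hi)) (fun n ih h0 i hi => ?_) n
    rw [first_suc] at h0
    split_ifs at h0 with h1
    · rcases (lt_suc_iff.1 hi).lt_or_eq with h2 | rfl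
      · exact ih h1 i h2
      · exact h0
    · exact absurd h0 h1
  · refine nat_induction (p := fun n => (∀ i, i < n → h i = 0) → first h n = 0)
      ⟨[.one], .imp (.all .nat (.imp (lt v0 v1) (.eq (v2 ⬝ v0) zero))) (.eq (firstT v1 v0) zero),
        Env.nil.ext h, by simp, fun x => by simp⟩
      (fun _ => by simp) (fun n ih h0 => ?_) n
    rw [first_suc, if_pos (ih fun i hi => h0 i (hi.trans (lt_suc_self n)))]
    exact h0 n (lt_suc_self n)

/-- There is a standard functional that yields a modulus of continuity at the constant function
`0`, for each standard continuous functional. -/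
theorem HasNPC.exists_modulusFunctional (hM : HasNPC M) :
    ∃ Ω : M.El (.two ⇒ .nat), M.st Ω ∧ ∀ Y, M.st Y → Cont Y → ∀ g : M.El .one,
      (∀ i, i ≤ Ω Y → g i = 0) → Y g = Y ((lam zero).eval .nil) := by
  obtain ⟨F, hF, h⟩ := hac (M := M) (σ := .two) (τ := .nat) (r := fun Y N => Cont Y →
      ∀ g : M.El .one, (∀ i, i ≤ N → g i = 0) → Y g = Y ((lam zero).eval .nil))
    ⟨[], .imp (cont v1) (.all .one (.imp (agree v0 (lam zero) v1)
        (.eq (v2 ⬝ v0) (v2 ⬝ lam zero)))), .nil, by simp, fun x y => by simp; rfl⟩ (fun Y hY => by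
      by_cases hc : Cont Y
      · obtain ⟨N, hN, h⟩ := hM.exists_modulus hY hc (st_eval (M := M) st_nil (lam zero))
        exact ⟨N, hN, fun _ g hg => (h g fun i hi => by simp [hg i hi]).symm⟩
      · exact ⟨0, st_zero, fun h => absurd h hc⟩)
  refine ⟨(lam (maxT (v1 ⬝ v0))).eval (Env.nil.ext F), st_eval (st_ext st_nil hF) _,
    fun Y hY hc g hg => ?_⟩
  obtain ⟨N, hN, h⟩ := h Y hY
  refine h hc g fun i hi => hg i (hi.trans ?_)
  rw [eval_lam]
  exact le_maxT _ _ _ hN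

/-- Grilliot's trick: since a modulus functional is discontinuous in the functional to which it is
applied, it decides whether a standard function vanishes everywhere. -/
theorem HasNPC.exists_decide (hM : HasNPC M) :
    ∃ E : M.El (.one ⇒ .nat), M.st E ∧ ∀ h, M.st h → (E h = 0 ↔ ∀ n, h n = 0) := by
  obtain ⟨Ω, hΩ, hm⟩ := hM.exists_modulusFunctional
  let Z : M.El .two := (lam zero).eval .nil
  have hZ : M.st Z := st_eval st_nil _
  let N₀ := Ω Z
  -- `Y h g` tests `h` below `g (N₀ + 1)`, a place which the modulus `N₀` of `Z` does not reach
  let Yt : Tm [.one, .nat, .two ⇒ .nat] .two := lam (firstT v1 (v0 ⬝ succ v2))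
  let e : Env M [.nat, .two ⇒ .nat] := (Env.nil.ext Ω).ext N₀
  have he := st_ext (st_ext (M := M) st_nil hΩ) (st_app hΩ hZ)
  have hY (h g : M.El .one) : Yt.eval (e.ext h) g = first h (g (suc N₀)) := by
    simp [Yt, e]
  refine ⟨(lam (NSA.monus (v2 ⬝ Yt) v1)).eval e, st_eval he _, fun h hh => ?_⟩
  have hst : M.st (Yt.eval (e.ext h)) := st_eval (st_ext he hh) _
  have hE : (lam (NSA.monus (v2 ⬝ Yt) v1)).eval e h = 0 ↔ Ω (Yt.eval (e.ext h)) ≤ N₀ := by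
    rw [eval_lam, le_def, eval_monus]; rfl
  rw [hE]
  constructor
  · intro hle n
    have hc : Cont (Yt.eval (e.ext h)) := fun f => ⟨suc N₀, fun g hg => by
      rw [hY, hY, hg _ le_rfl]⟩
    let g : M.El .one := (lam (ifZero (NSA.monus v0 v1) zero (succ v2))).eval
      ((Env.nil.ext n).ext N₀)
    have h1 := hm _ hst hc g fun i hi => by
      have : monus i N₀ = 0 := hi.trans hle
      simp [g, this]
    have h2 : g (suc N₀) = suc n := by
      have : monus (suc N₀) N₀ ≠ 0 := not_suc_le_self N₀
      simp [g, this]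
    rw [hY, hY, h2, eval_lam, Tm.eval_zero, first_zero, first_eq_zero] at h1
    exact h1 n (lt_suc_self n)
  · intro h0
    have : Yt.eval (e.ext h) = Z := app_ext fun g => by
      rw [hY, eval_lam, Tm.eval_zero, first_eq_zero]
      exact fun i _ => h0 i
    rw [this]

/-- Transfer: a standard function that vanishes at all standard numbers vanishes everywhere. -/
theorem HasNPC.transfer (hM : HasNPC M) {h : M.El .one} (hh : M.st h)
    (h0 : ∀ n, M.st n → h n = 0) (n : M.El .nat) : h n = 0 := by
  obtain ⟨E, hE, hd⟩ := hM.exists_decide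
  -- `f` keeps only the first nonzero value of `h`
  let f : M.El .one := (lam (ifZero (firstT v1 v0) (v1 ⬝ v0) zero)).eval (Env.nil.ext h)
  have hf : M.st f := st_eval (st_ext st_nil hh) _
  have hfv (k : M.El .nat) (hk : f k ≠ 0) : first h k = 0 ∧ h k ≠ 0 := by
    by_cases h1 : first h k = 0 <;> simp_all [f]
  by_cases hm : ∃ m, f m ≠ 0
  · exfalso
    obtain ⟨m, hm⟩ := hm
    have huniq (k : M.El .nat) (hk : k ≠ m) : f k = 0 := by
      by_contra h1
      have h2 := hfv k h1
      have h3 := hfv m hm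
      rcases lt_or_gt_of_ne hk with h4 | h4
      · exact h2.2 (first_eq_zero.1 h3.1 k h4)
      · exact h3.2 (first_eq_zero.1 h2.1 m h4)
    let It : Tm [.one, .one, .one ⇒ .nat] .one := lam (ifZero (v1 ⬝ v0) zero (v2 ⬝ v0))
    let e : Env M [.one, .one ⇒ .nat] := (Env.nil.ext E).ext f
    have he := st_ext (st_ext (M := M) st_nil hE) hf
    have hI (g : M.El .one) (k : M.El .nat) :
        It.eval (e.ext g) k = 0 ∨ g k ≠ 0 ∧ It.eval (e.ext g) k = f k := by
      by_cases h1 : g k = 0 <;> simp [It, e, h1]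
    have hI' (g : M.El .one) (k : M.El .nat) (h1 : g k = 0 → f k = 0) :
        It.eval (e.ext g) k = f k := by
      by_cases h2 : g k = 0 <;> simp [It, e, h2]
      exact (h1 h2).symm
    -- `Z g` depends only on whether `g m` is `0`, because `E` is applied to `0` or to `f`
    let Z : M.El .two := (lam (v2 ⬝ It)).eval e
    have hZ : M.st Z := st_eval he _
    have hZv (g : M.El .one) : Z g = E (It.eval (e.ext g)) := by
      rw [eval_lam]; rfl
    have hc : Cont Z := fun g => ⟨m, fun g' hg => by
      rw [hZv, hZv]
      congr 1
      refine app_ext fun k => ?_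
      by_cases hk : k = m
      · subst hk
        have h1 := hg k le_rfl
        by_cases h2 : g k = 0 <;> simp [It, e, h1, h2]
      · rcases hI g k with h1 | ⟨-, h1⟩ <;> rcases hI g' k with h2 | ⟨-, h2⟩ <;>
          simp [h1, h2, huniq k hk]⟩
    have hO : M.st ((lam zero).eval (Γ := []) Env.nil : M.El .one) := st_eval st_nil _
    have h1 := hM Z hZ hc _ hO f fun n hn => by
      rw [eval_lam, Tm.eval_zero]
      by_contra hn'
      exact (hfv n (Ne.symm hn')).2 (h0 n hn)
    have h2 : Z ((lam zero).eval (Γ := []) Env.nil) = 0 := by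
      rw [hZv, hd _ (st_eval (st_ext he hO) _)]
      intro k
      rcases hI ((lam zero).eval (Γ := []) Env.nil) k with h1 | ⟨h1, -⟩
      · exact h1
      · simp at h1
    have h3 : It.eval (e.ext f) = f := app_ext fun k => hI' f k id
    rw [h2, hZv, h3] at h1
    exact hm ((hd f hf).1 h1.symm m)
  · have hm' (m : M.El .nat) : f m = 0 := by
      by_contra h
      exact hm ⟨m, h⟩
    have h1 : ∀ n, first h n = 0 := by
      refine nat_induction ⟨[.one], .eq (firstT v1 v0) zero, Env.nil.ext h, by simp,
        fun x => by simp⟩ (by simp) fun n hn => ?_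
      have := hm' n
      rw [first_suc, if_pos hn]
      simpa [f, hn] using this
    exact first_eq_zero.1 (h1 (suc n)) n (lt_suc_self n)

theorem pickT_spec {Γ : List Ty} (e : Env M Γ) (h : Tm Γ .one) (w : Tm Γ (.seq .nat))
    {x : M.El .nat} (hx : Mem x (w.eval e)) (hn : h.eval e x ≠ 0) :
    h.eval e ((pickT h w).eval e) ≠ 0 := by
  set h' := h.eval e with hh'
  have key (w : M.El (.seq .nat)) : ∀ x, Mem x w → h' x ≠ 0 →
      h' ((pickT v1 v0).eval ((Env.nil.ext h').ext w)) ≠ 0 := by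
    refine seq_induction (p := fun w => ∀ x, Mem x w → h' x ≠ 0 →
        h' ((pickT v1 v0).eval ((Env.nil.ext h').ext w)) ≠ 0)
      ⟨[.one], .all .nat (.imp (mem v0 v1) (.imp (.neg (.eq (v2 ⬝ v0) zero))
        (.neg (.eq (v2 ⬝ pickT v2 v1) zero)))), Env.nil.ext h', by simp, fun w => ?_⟩
      (fun x hx => absurd hx (not_mem_nil x)) (fun y w ih x hx hn => ?_) w
    · simp only [Fm.sat_all, Fm.sat_imp, Fm.sat_neg, Fm.sat_mem, Fm.sat_eq, Tm.eval_app,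
        Tm.eval_v0, Tm.eval_v1, Tm.eval_v2, Tm.eval_zero]
      rfl
    · have h1 : (pickT v1 v0).eval ((Env.nil.ext h').ext (cons y w)) =
          if h' y = 0 then (pickT v1 v0).eval ((Env.nil.ext h').ext w) else y := by
        simp only [pickT, Tm.eval_recL, Tm.eval_v0, recL_cons, eval_lam, eval_ifZero, Tm.eval_app,
          Tm.eval_wk, Tm.eval_v1]
        rfl
      rw [h1]
      split_ifs with h2
      · rcases mem_cons hx with rfl | hx
        · exact absurd h2 hn
        · exact ih x hx hn
      · exact h2
  have := key (w.eval e) x hx hn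
  convert this using 2
  simp only [pickT, Tm.eval_recL, Tm.eval_v0, Tm.eval_zero]
  congr 1
  exact app_ext fun a => app_ext fun b => by simp [hh']

/-- There is a standard search functional for standard functions. -/
theorem HasNPC.exists_search (hM : HasNPC M) :
    ∃ μ : M.El (.one ⇒ .nat), M.st μ ∧ ∀ h : M.El .one, M.st h → ∀ n, h n ≠ 0 → h (μ h) ≠ 0 := by
  obtain ⟨F, hF, h⟩ := hac (M := M) (σ := .one) (τ := .nat)
    (r := fun h n => ∀ m, h m ≠ 0 → h n ≠ 0)
    ⟨[], .all .nat (.imp (.neg (.eq (v2 ⬝ v0) zero)) (.neg (.eq (v2 ⬝ v1) zero))), .nil, by simp,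
      fun x y => by simp⟩ (fun h hh => by
      by_cases h1 : ∃ n, M.st n ∧ h n ≠ 0
      · obtain ⟨n, hn, h1⟩ := h1
        exact ⟨n, hn, fun _ _ => h1⟩
      · refine ⟨0, st_zero, fun m hm => absurd (hM.transfer hh (fun n hn => ?_) m) hm⟩
        by_contra h2
        exact h1 ⟨n, hn, h2⟩)
  refine ⟨(lam (pickT v0 (v1 ⬝ v0))).eval (Env.nil.ext F), st_eval (st_ext st_nil hF) _,
    fun g hg n hn => ?_⟩
  obtain ⟨k, hk, h⟩ := h g hg
  rw [eval_lam]
  exact pickT_spec ((Env.nil.ext F).ext g) v0 (v1 ⬝ v0) hk (h n hn)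

end Str

namespace Str

variable {M : Str} [ModelsP M]

/-! ### Bar induction -/

/-- Bar induction for standard continuous functionals `Y`: a standard property `B s ≠ 0` of
standard finite sequences holds everywhere if it holds where `Y` is secured, and is inherited from
the extensions of `s` by a positive standard number to `s` itself. -/
theorem HasNPC.bar_induction (hM : HasNPC M) {Y : M.El .two} (hY : M.st Y) (hc : Cont Y)
    {B : M.El (.seq .nat ⇒ .nat)} (hB : M.st B)
    (sec : ∀ s, M.st s → (∀ a b : M.El .one, Y (cat s a) = Y (cat s b)) → B s ≠ 0)
    (prog : ∀ s, M.st s → (∀ n, M.st n → B (snoc s (suc n)) ≠ 0) → B s ≠ 0)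
    (s : M.El (.seq .nat)) (hs : M.st s) : B s ≠ 0 := by
  intro hs0
  obtain ⟨μ, hμ, hsearch⟩ := hM.exists_search
  -- `next` extends a sequence with `B r = 0` by a number found by search, such that this persists
  let next : M.El (.seq .nat ⇒ .seq .nat) := (lam (NSA.snoc v0 (succ (v2 ⬝ lam
    (ifZero (v2 ⬝ NSA.snoc v1 (succ v0)) (succ zero) zero))))).eval ((Env.nil.ext μ).ext B)
  have hnext : M.st next := st_eval (st_ext (st_ext st_nil hμ) hB) _
  have hsnoc (r : M.El (.seq .nat)) : ∃ x, next r = snoc r x := ⟨_, by simp [next]; rfl⟩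
  have hnextB (r : M.El (.seq .nat)) (hr : M.st r) (hr0 : B r = 0) : B (next r) = 0 := by
    let q : M.El .one := (lam (ifZero (v2 ⬝ NSA.snoc v1 (succ v0)) (succ zero) zero)).eval
      ((Env.nil.ext B).ext r)
    have hq : M.st q := st_eval (st_ext (st_ext st_nil hB) hr) _
    have hqv (n : M.El .nat) : q n ≠ 0 ↔ B (snoc r (suc n)) = 0 := by
      by_cases h : B (snoc r (suc n)) = 0 <;> simp [q, h, suc_ne_zero]
    have h1 : ∃ n, q n ≠ 0 := by
      by_contra! h
      refine prog r hr (fun n _ hn => ?_) hr0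
      exact (hqv n).2 hn (h n)
    obtain ⟨n, hn⟩ := h1
    have := (hqv _).1 (hsearch q hq n hn)
    have h2 : next r = snoc r (suc (μ q)) := by simp [next]; rfl
    rw [h2, this]
  let path : M.El (.nat ⇒ .seq .nat) := (lam (NSA.recN v1 (lam (lam
    (.var (.s (.s (.s (.s .z)))) ⬝ v1))) v0)).eval ((Env.nil.ext next).ext s)
  have hpath : M.st path := st_eval (st_ext (st_ext st_nil hnext) hs) _
  have path0 : path 0 = s := by simp [path]
  have pathS (n : M.El .nat) : path (suc n) = next (path n) := by simp [path]; rfl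
  have hpathB : ∀ n, M.st n → B (path n) = 0 :=
    st_induction (.eq (v2 ⬝ (v1 ⬝ v0)) zero) ((Env.nil.ext B).ext path) (fun x => by simp)
      (by rwa [path0]) fun n hn ih => by
        rw [pathS]
        exact hnextB _ (st_app hpath hn) ih
  have hlen : ∀ n, n ≤ len (path n) := by
    refine nat_induction ⟨[.nat ⇒ .seq .nat], le v0 (NSA.len (v1 ⬝ v0)), Env.nil.ext path, by simp,
      fun x => by simp⟩ (by simp) fun n hn => ?_
    obtain ⟨x, hx⟩ := hsnoc (path n)
    rwa [pathS, hx, len_snoc, suc_le_suc]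
  have hcoh : ∀ j i, i < j → nth (path j) i = nth (path (suc i)) i := by
    refine nat_induction ⟨[.nat ⇒ .seq .nat], .all .nat (.imp (lt v0 v1)
      (.eq (NSA.nth (v2 ⬝ v1) v0) (NSA.nth (v2 ⬝ succ v0) v0))), Env.nil.ext path, by simp,
      fun x => by simp⟩ (fun i hi => absurd rfl (ne_zero_of_lt hi)) fun j ih i hi => ?_
    rcases (lt_suc_iff.1 hi).lt_or_eq with h | rfl
    · obtain ⟨x, hx⟩ := hsnoc (path j)
      rw [← ih i h, pathS, hx, nth, cat_snoc]
      exact cat_of_lt (h.trans_le (hlen j)) _ _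
    · rfl
  let α : M.El .one := (lam (NSA.nth (v1 ⬝ succ v0) v0)).eval (Env.nil.ext path)
  obtain ⟨N, hN, hmod⟩ := hM.exists_modulus hY hc (f := α) (st_eval (st_ext st_nil hpath) _)
  -- the initial segment of `α` up to the modulus of `Y` at `α` is secured
  have hα (a : M.El .one) : Y α = Y (cat (path (suc N)) a) := by
    refine hmod _ fun i hi => ?_
    rw [← lt_suc_iff] at hi
    rw [cat_of_lt (hi.trans_le (hlen _)) a ((dflt (.nat ⇒ .nat)).eval .nil)]
    have := hcoh (suc N) i hi
    rw [nth] at this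
    rw [this]
    simp [α]
  exact sec _ (st_app hpath (st_suc hN)) (fun a b => by rw [← hα, ← hα]) (hpathB _ (st_suc hN))

end Str

namespace Str

variable {M : Str}

/-! ### Limits of approximations -/

/-- A number that is `0` if and only if `a = b`, as a term. -/
def diffT {Γ : List Ty} (a b : Tm Γ .nat) : Tm Γ .nat :=
  ifZero (NSA.monus a b) (NSA.monus b a) (succ zero)

/-- The functional `F` satisfies the recursion of the Gandy-Hyland functional at all standard
arguments. -/
def IsGH (F : M.El .gam) : Prop :=
  ∀ Y, M.st Y → Cont Y → ∀ s, M.st s → ∃ a : M.El .one,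
    (∀ n, a n = F Y (snoc s (suc n))) ∧ F Y s = Y (cat (snoc s 0) a)

/-- The functional `X` is standard and satisfies, below the length `N`, the recursion of the
Gandy-Hyland functional up to values of the branching beyond `N`. Both approximations `G` and `H`
do. -/
def IsApprox (X : M.El .appr) : Prop :=
  M.st X ∧ ∀ Y s N, ¬ N ≤ len s → ∃ a : M.El .one,
    X Y s N = Y (cat (snoc s 0) a) ∧ ∀ n, suc n ≤ N → a n = X Y (snoc s (suc n)) N

variable [ModelsP M]

theorem eval_diffT {Γ : List Ty} (e : Env M Γ) (a b : Tm Γ .nat) :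
    (diffT a b).eval e = 0 ↔ a.eval e = b.eval e := by
  rw [diffT, eval_ifZero, eval_monus, eval_monus]
  split_ifs with h
  · exact ⟨fun h' => le_antisymm h h', fun h' => h'.ge⟩
  · refine ⟨fun h' => absurd h' (suc_ne_zero _), fun h' => absurd (le_def.1 h'.le) h⟩

/-- At a standard sequence `s`, a functional `Y` takes the same value at `s * 0 * a` for all `a`
that agree with a standard `v` at all standard places. -/
theorem HasNPC.apply_cat_eq (hM : HasNPC M) {Y : M.El .two} (hY : M.st Y) (hc : Cont Y)
    {s : M.El (.seq .nat)} (hs : M.st s) {v a : M.El .one} (hv : M.st v)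
    (h : ∀ n, M.st n → a n = v n) : Y (cat (snoc s 0) a) = Y (cat (snoc s 0) v) := by
  have hst : M.st (cat (snoc s 0) v) := by
    simpa using st_eval (st_ext (st_ext (M := M) st_nil hs) hv) (NSA.cat (NSA.snoc v1 zero) v0)
  refine (hM Y hY hc _ hst _ fun n hn => ?_).symm
  exact cat_congr _ fun m hm => (h m (st_of_le hm hn)).symm

/-- The approximation `X` stabilises at standard arguments, by bar induction, and its limit is a
standard Gandy-Hyland functional. -/
theorem HasNPC.exists_limit (hM : HasNPC M) {X : M.El .appr} (hX : IsApprox X) :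
    ∃ F : M.El .gam, M.st F ∧ IsGH F ∧ ∀ Y, M.st Y → Cont Y → ∀ s, M.st s →
      ∀ N, ¬ M.st N → X Y s N = F Y s := by
  obtain ⟨hXst, hX⟩ := hX
  obtain ⟨μ, hμ, hsearch⟩ := hM.exists_search
  let e : Env M [.one ⇒ .nat, .appr] := (Env.nil.ext X).ext μ
  have he := st_ext (st_ext (M := M) st_nil hXst) hμ
  -- `C` vanishes if `X Y s` is constant from `k` on, and `D k ≠ 0` expresses that it does
  let C : Tm [.nat, .seq .nat, .two, .one ⇒ .nat, .appr] .one :=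
    lam (ifZero (NSA.monus v1 v0) (diffT (.var (.s (.s (.s (.s (.s .z))))) ⬝ v3 ⬝ v2 ⬝ v0)
      (.var (.s (.s (.s (.s (.s .z))))) ⬝ v3 ⬝ v2 ⬝ v1)) zero)
  let D : Tm [.seq .nat, .two, .one ⇒ .nat, .appr] .one :=
    lam (ifZero (C ⬝ (v3 ⬝ C)) (succ zero) zero)
  let Good (Y : M.El .two) (s : M.El (.seq .nat)) (k : M.El .nat) : Prop :=
    ∀ j, k ≤ j → X Y s j = X Y s k
  have hC (Y s k) : (∀ j, C.eval (((e.ext Y).ext s).ext k) j = 0) ↔ Good Y s k := by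
    refine forall_congr' fun j => ?_
    simp only [C, eval_lam, eval_ifZero, eval_monus, Tm.eval_v0, Tm.eval_v1, ← le_def]
    split_ifs with h
    · rw [eval_diffT]
      simp [h, e]
    · simp [h]
  have hD (Y s k) (hY : M.st Y) (hs : M.st s) (hk : M.st k) :
      D.eval ((e.ext Y).ext s) k ≠ 0 ↔ Good Y s k := by
    rw [← hC, eval_lam]
    have hCst : M.st (C.eval (((e.ext Y).ext s).ext k)) :=
      st_eval (st_ext (st_ext (st_ext he hY) hs) hk) C
    have h1 := hsearch _ hCst
    rw [eval_ifZero]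
    constructor
    · intro h j
      by_contra hj
      exact h (if_neg (h1 j hj))
    · intro h
      rw [if_pos (show (C ⬝ (v3 ⬝ C)).eval _ = 0 from h _)]
      exact suc_ne_zero _
  let Ft : Tm [.seq .nat, .two, .one ⇒ .nat, .appr] .nat := v3 ⬝ v1 ⬝ v0 ⬝ (v2 ⬝ D)
  let F : M.El .gam := (lam (lam Ft)).eval e
  have hF : M.st F := st_eval he _
  let κ (Y : M.El .two) (s : M.El (.seq .nat)) : M.El .nat := μ (D.eval ((e.ext Y).ext s))
  have hFv (Y s) : F Y s = X Y s (κ Y s) := by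
    simp only [F, eval_lam]; rfl
  have hsuc {s : M.El (.seq .nat)} (hs : M.st s) {n} (hn : M.st n) : M.st (snoc s (suc n)) := by
    simpa using st_eval (st_ext (st_ext (M := M) st_nil hs) hn) (NSA.snoc v1 (succ v0))
  let V (Y : M.El .two) (s : M.El (.seq .nat)) : M.El .one :=
    (lam (v3 ⬝ v2 ⬝ NSA.snoc v1 (succ v0))).eval (((Env.nil.ext F).ext Y).ext s)
  have hV (Y s n) : V Y s n = F Y (snoc s (suc n)) := by simp [V]
  have hκ {Y s} (hY : M.st Y) (hs : M.st s) : M.st (κ Y s) :=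
    st_app hμ (st_eval (st_ext (st_ext he hY) hs) D)
  have step {Y s} (hY : M.st Y) (hc : Cont Y) (hs : M.st s)
      (h : ∀ n, M.st n → Good Y (snoc s (suc n)) (κ Y (snoc s (suc n)))) {N} (hN : ¬ M.st N) :
      X Y s N = Y (cat (snoc s 0) (V Y s)) := by
    have hlen : M.st (len s) := by
      simpa using st_eval (st_ext (M := M) st_nil hs) (NSA.len v0)
    obtain ⟨a, h1, h2⟩ := hX Y s N fun h => hN (st_of_le h hlen)
    rw [h1]
    refine hM.apply_cat_eq hY hc hs
      (st_eval (st_ext (st_ext (st_ext st_nil hF) hY) hs) _) fun n hn => ?_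
    rw [h2 n (le_of_st_of_not_st (st_suc hn) hN), hV, hFv]
    exact h n hn N (le_of_st_of_not_st (hκ hY (hsuc hs hn)) hN)
  have all {Y} (hY : M.st Y) (hc : Cont Y) {s} (hs : M.st s) : Good Y s (κ Y s) := by
    let B : M.El (.seq .nat ⇒ .nat) := (lam (D ⬝ (v2 ⬝ D))).eval (e.ext Y)
    have hB (s) : B s = D.eval ((e.ext Y).ext s) (κ Y s) := by
      simp only [B, eval_lam]; rfl
    have hB' {s} (hs : M.st s) : B s ≠ 0 ↔ Good Y s (κ Y s) := by
      rw [hB, hD Y s _ hY hs (hκ hY hs)]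
    have hGood {s} (hs : M.st s) {k} (hk : M.st k) (h : Good Y s k) : B s ≠ 0 := by
      rw [hB]
      exact hsearch _ (st_eval (st_ext (st_ext he hY) hs) D) k ((hD Y s k hY hs hk).2 h)
    rw [← hB' hs]
    refine hM.bar_induction hY hc (st_eval (st_ext he hY) _) (fun s hs h => ?_)
      (fun s hs h => ?_) s hs
    · have hlen : M.st (suc (len s)) := by
        simpa using st_eval (st_ext (M := M) st_nil hs) (succ (NSA.len v0))
      refine hGood hs hlen fun j hj => ?_
      obtain ⟨a, ha, -⟩ := hX Y s j (not_le.2 (suc_le_iff.1 hj))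
      obtain ⟨b, hb, -⟩ := hX Y s (suc (len s)) (not_suc_le_self _)
      rw [ha, hb, cat_snoc, cat_snoc]
      exact h _ _
    · obtain ⟨k, hk, h1⟩ := underspill
        (p := fun k => ∀ j, k ≤ j → X Y s j = Y (cat (snoc s 0) (V Y s)))
        ⟨[.nat, .seq .nat, .two, .appr], .all .nat (.imp (le v1 v0)
            (.eq (.var (.s (.s (.s (.s (.s .z))))) ⬝ .var (.s (.s (.s (.s .z)))) ⬝ v3 ⬝ v0) v2)),
          (((Env.nil.ext X).ext Y).ext s).ext (Y (cat (snoc s 0) (V Y s))), by simp,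
          fun x => by simp⟩
        fun k hk j hj => step hY hc hs (fun n hn => (hB' (hsuc hs hn)).1 (h n hn))
          fun hj' => hk (st_of_le hj hj')
      exact hGood hs hk fun j hj => by rw [h1 j hj, h1 k le_rfl]
  have lim {Y} (hY : M.st Y) (hc : Cont Y) {s} (hs : M.st s) {N} (hN : ¬ M.st N) :
      X Y s N = F Y s := by
    rw [hFv]
    exact all hY hc hs N (le_of_st_of_not_st (hκ hY hs) hN)
  refine ⟨F, hF, fun Y hY hc s hs => ⟨V Y s, hV Y s, ?_⟩, fun Y hY hc s hs N hN => lim hY hc hs hN⟩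
  obtain ⟨N, hN⟩ := exists_not_st (M := M)
  rw [← lim hY hc hs hN]
  exact step hY hc hs (fun n hn => all hY hc (hsuc hs hn)) hN

end Str

namespace Str

/-! ### Coding of finite sequences of numbers -/

/-- Doubling, as a term. -/
def dblT {Γ : List Ty} (n : Tm Γ .nat) : Tm Γ .nat := NSA.recN zero (lam (lam (succ (succ v1)))) n

/-- `2 ^ a * (2 * r + 1)`, as a term. -/
def oddT {Γ : List Ty} (r a : Tm Γ .nat) : Tm Γ .nat :=
  NSA.recN (succ (dblT r)) (lam (lam (dblT v1))) a

/-- The code of a finite sequence of numbers: `0` for the empty sequence, and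
`2 ^ a * (2 * r + 1)` for `a` prefixed to a sequence with code `r`. -/
def codeT {Γ : List Ty} (w : Tm Γ (.seq .nat)) : Tm Γ .nat :=
  NSA.recL zero (lam (lam (oddT v1 v0))) w

variable {M : Str}

/-- Doubling. -/
def dbl (n : M.El .nat) : M.El .nat := (dblT v0).eval (Env.nil.ext n)

/-- `2 ^ a * (2 * r + 1)`. -/
def odd (r a : M.El .nat) : M.El .nat := (oddT v1 v0).eval ((Env.nil.ext r).ext a)

/-- The code of a finite sequence of numbers. -/
def code (w : M.El (.seq .nat)) : M.El .nat := (codeT v0).eval (Env.nil.ext w)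

theorem eval_dblT {Γ : List Ty} (e : Env M Γ) (n : Tm Γ .nat) :
    (dblT n).eval e = dbl (n.eval e) := rfl

theorem eval_oddT {Γ : List Ty} (e : Env M Γ) (r a : Tm Γ .nat) :
    (oddT r a).eval e = odd (r.eval e) (a.eval e) := rfl

theorem eval_codeT {Γ : List Ty} (e : Env M Γ) (w : Tm Γ (.seq .nat)) :
    (codeT w).eval e = code (w.eval e) := rfl

variable [ModelsP M]

theorem dbl_zero : dbl (0 : M.El .nat) = 0 := by simp [dbl, dblT]

theorem dbl_suc (n : M.El .nat) : dbl (suc n) = suc (suc (dbl n)) := by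
  simp [dbl, dblT]; rfl

theorem odd_zero (r : M.El .nat) : odd r 0 = suc (dbl r) := by
  simp [odd, oddT, eval_dblT]

theorem odd_suc (r a : M.El .nat) : odd r (suc a) = dbl (odd r a) := by
  simp [odd, oddT, eval_dblT]; rfl

theorem code_nil : code (nil : M.El (.seq .nat)) = 0 := by simp [code, codeT]

theorem code_cons (a : M.El .nat) (w : M.El (.seq .nat)) :
    code (cons a w) = odd (code w) a := by
  simp [code, codeT, eval_oddT]; rfl

/-- Definition by primitive recursion on sequences, where the step may use the tail. -/
theorem exists_seqRec (x : M.El (.seq .nat))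
    (f : M.El (.seq .nat ⇒ .nat ⇒ .seq .nat ⇒ .seq .nat)) :
    ∃ p : M.El (.seq .nat ⇒ .seq .nat),
      p nil = x ∧ ∀ a w, p (cons a w) = f (p w) a w := by
  -- by list recursion, a function that takes the value `w` at `0` and `p w` at `1`
  let q : M.El (.seq .nat ⇒ .nat ⇒ .seq .nat) := (lam (NSA.recL (lam (ifZero v0 NSA.nil v2))
    (lam (lam (lam (ifZero v0 (NSA.cons v1 (v2 ⬝ zero))
      (.var (.s (.s (.s (.s (.s .z))))) ⬝ (v2 ⬝ succ zero) ⬝ v1 ⬝ (v2 ⬝ zero)))))) v0)).eval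
    ((Env.nil.ext f).ext x)
  have q_nil (i) : q nil i = if i = 0 then nil else x := by simp [q]; rfl
  have q_cons (a w i) : q (cons a w) i =
      if i = 0 then cons a (q w 0) else f (q w (suc 0)) a (q w 0) := by
    simp [q]; rfl
  have q_zero : ∀ w, q w 0 = w := by
    refine seq_induction ⟨[.seq .nat ⇒ .nat ⇒ .seq .nat], .eq (v1 ⬝ v0 ⬝ zero) v0,
      Env.nil.ext q, by simp, fun x => by simp⟩ (by simp [q_nil]) fun a w h => by simp [q_cons, h]
  refine ⟨(lam (v1 ⬝ v0 ⬝ succ zero)).eval (Env.nil.ext q), ?_, fun a w => ?_⟩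
  · simp [q_nil, suc_ne_zero]
  · simp [q_cons, suc_ne_zero, q_zero]

/-- Every number in the range of the coding can be decoded. -/
theorem exists_decode : ∃ d : M.El (.nat ⇒ .seq .nat), ∀ w, d (code w) = w := by
  -- `D` and `step` are the operations on sequences that correspond to doubling and to successor
  obtain ⟨D, D_nil, D_cons⟩ := exists_seqRec (M := M) nil
    ((lam (lam (lam (NSA.cons (succ v1) v0)))).eval .nil)
  obtain ⟨step, step_nil, step_cons⟩ := exists_seqRec (M := M) (cons 0 nil)
    ((lam (lam (lam (ifZero v1 (v3 ⬝ v2)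
      (NSA.cons zero (NSA.cons (NSA.pred v1) v0)))))).eval (Env.nil.ext D))
  simp only [eval_lam, Tm.eval_cons, Tm.eval_succ, Tm.eval_v0, Tm.eval_v1] at D_cons
  have step_zero (w) : step (cons 0 w) = D (step w) := by simp [step_cons]
  have step_suc (a w) : step (cons (suc a) w) = cons 0 (cons a w) := by
    simp [step_cons, suc_ne_zero]
  have step_D (w) : step (D w) = cons 0 w := by
    rcases seq_cases w with rfl | ⟨a, w, rfl⟩
    · rw [D_nil, step_nil]
    · rw [D_cons, step_suc]
  let d : M.El (.nat ⇒ .seq .nat) := (lam (NSA.recN NSA.nil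
    (lam (lam (.var (.s (.s (.s .z))) ⬝ v1))) v0)).eval (Env.nil.ext step)
  have d_zero : d 0 = nil := by simp [d]
  have d_suc (n) : d (suc n) = step (d n) := by simp [d]; rfl
  have d_dbl : ∀ n, d (dbl n) = D (d n) := by
    refine nat_induction ⟨[.nat ⇒ .seq .nat, .seq .nat ⇒ .seq .nat],
      .eq (v1 ⬝ dblT v0) (v2 ⬝ (v1 ⬝ v0)), (Env.nil.ext D).ext d, by simp,
      fun x => by simp [eval_dblT]⟩ (by rw [dbl_zero, d_zero, D_nil]) fun n ih => ?_
    rw [dbl_suc, d_suc, d_suc, ih, step_D, step_zero, d_suc]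
  have d_odd (r) : ∀ a, d (odd r a) = cons a (d r) := by
    refine nat_induction ⟨[.nat ⇒ .seq .nat, .nat],
      .eq (v1 ⬝ oddT v2 v0) (NSA.cons v0 (v1 ⬝ v2)), (Env.nil.ext r).ext d, by simp,
      fun x => by simp [eval_oddT]⟩ ?_ fun a ih => ?_
    · rw [odd_zero, d_suc, d_dbl, step_D]
    · rw [odd_suc, d_dbl, ih, D_cons]
  refine ⟨d, seq_induction ⟨[.nat ⇒ .seq .nat], .eq (v1 ⬝ codeT v0) v0, Env.nil.ext d, by simp,
    fun x => by simp [eval_codeT]⟩ ?_ fun a w ih => ?_⟩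
  · rw [code_nil, d_zero]
  · rw [code_cons, d_odd, ih]

/-! ### Uniqueness of the Gandy-Hyland functional -/

/-- At standard arguments, every Gandy-Hyland functional agrees with every standard one: the set of
arguments at which they agree has a standard part, to which bar induction applies. -/
theorem IsGH.eq_of_st (hM : HasNPC M) (hS : HasSTP M) {F F' : M.El .gam} (hF : M.st F)
    (h : IsGH F) (h' : IsGH F') {Y : M.El .two} (hY : M.st Y) (hc : Cont Y)
    {s : M.El (.seq .nat)} (hs : M.st s) : F' Y s = F Y s := by
  obtain ⟨d, hd⟩ := exists_decode (M := M)
  let f : M.El .one := (lam (ifZero (diffT (v3 ⬝ v2 ⬝ (v1 ⬝ v0))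
    (.var (.s (.s (.s (.s .z)))) ⬝ v2 ⬝ (v1 ⬝ v0))) (succ zero) zero)).eval
    ((((Env.nil.ext F').ext F).ext Y).ext d)
  have hf (p) : f p = if F Y (d p) = F' Y (d p) then suc 0 else 0 := by
    simp only [f, eval_lam, eval_ifZero, eval_diffT]
    rfl
  obtain ⟨g, hg, hfg⟩ := hS f fun p => by
    rw [hf]
    split_ifs <;> simp
  let B : M.El (.seq .nat ⇒ .nat) := (lam (v1 ⬝ codeT v0)).eval (Env.nil.ext g)
  have hB {s} (hs : M.st s) : B s ≠ 0 ↔ F' Y s = F Y s := by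
    have hcode : M.st (code s) := st_eval (st_ext (M := M) st_nil hs) (codeT v0)
    have : B s = g (code s) := by simp [B, eval_codeT]
    rw [this, ← hfg _ hcode, hf, hd, eq_comm (a := F' Y s)]
    split_ifs with h1 <;> simp [h1, suc_ne_zero]
  rw [← hB hs]
  refine hM.bar_induction hY hc (st_eval (st_ext st_nil hg) _) (fun s hs h1 => ?_)
    (fun s hs h1 => ?_) s hs
  · obtain ⟨a, -, ha⟩ := h Y hY hc s hs
    obtain ⟨b, -, hb⟩ := h' Y hY hc s hs
    rw [hB hs, ha, hb, cat_snoc, cat_snoc]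
    exact h1 _ _
  · obtain ⟨a, ha', ha⟩ := h Y hY hc s hs
    obtain ⟨b, hb', hb⟩ := h' Y hY hc s hs
    have hst : M.st a := by
      have : a = (lam (v3 ⬝ v2 ⬝ NSA.snoc v1 (succ v0))).eval
          (((Env.nil.ext F).ext Y).ext s) := app_ext fun n => by simp [ha']
      rw [this]
      exact st_eval (st_ext (st_ext (st_ext st_nil hF) hY) hs) _
    rw [hB hs, ha, hb]
    refine hM.apply_cat_eq hY hc hs hst fun n hn => ?_
    rw [ha', hb', ← hB]
    · exact h1 n hn
    · simpa using st_eval (st_ext (st_ext (M := M) st_nil hs) hn) (NSA.snoc v1 (succ v0))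

end Str

namespace Str

/-! ### The recursions of the approximations -/

variable {M : Str}

/-- The common form of the recursions of `G` and `H`: with values `b Y s N` at sequences of length
at least `N`, and with branching `n ↦ c N n (X Y (s * ⟨n + 1⟩) N)` below. -/
def IsRec (b : M.El .appr) (c : M.El (.nat ⇒ .nat ⇒ .nat ⇒ .nat)) (X : M.El .appr) : Prop :=
  ∀ Y s N, (N ≤ len s → X Y s N = b Y s N) ∧ (¬ N ≤ len s → ∃ a : M.El .one,
    (∀ n, a n = c N n (X Y (snoc s (suc n)) N)) ∧ X Y s N = Y (cat (snoc s 0) a))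

/-- The step of the recursion, as a term in `N`, `Y`, `c` and `b`. -/
def stepT : Tm [.nat, .two, .nat ⇒ .nat ⇒ .nat ⇒ .nat, .appr]
    ((.seq .nat ⇒ .nat) ⇒ .nat ⇒ .seq .nat ⇒ .nat) :=
  lam (lam (lam (.var (.s (.s (.s (.s .z)))) ⬝ NSA.cat (NSA.snoc v0 zero)
    (lam (.var (.s (.s (.s (.s (.s (.s .z)))))) ⬝ .var (.s (.s (.s (.s .z)))) ⬝ v0 ⬝
      (v3 ⬝ NSA.snoc v1 (succ v0)))))))

/-- Iteration of the recursion step, as a term in `c` and `b`: maps `Y`, `N` and the number of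
steps to a functional of `s`. -/
def iterT : Tm [.nat ⇒ .nat ⇒ .nat ⇒ .nat, .appr] (.two ⇒ .nat ⇒ .nat ⇒ .seq .nat ⇒ .nat) :=
  lam (lam (.cst (.R _) ⬝ lam (.var (.s (.s (.s (.s .z)))) ⬝ v2 ⬝ v0 ⬝ v1) ⬝ stepT))

/-- The solution of the recursion, from the iteration of its step: `N - |s|` steps are needed. -/
def ofIterT : Tm [.two ⇒ .nat ⇒ .nat ⇒ .seq .nat ⇒ .nat] .appr :=
  lam (lam (lam (v3 ⬝ v2 ⬝ v0 ⬝ NSA.monus v0 (NSA.len v1) ⬝ v1)))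

/-- The closed term that solves the recursion with closed data. -/
def solT (b : Tm [] .appr) (c : Tm [] (.nat ⇒ .nat ⇒ .nat ⇒ .nat)) : Tm [] .appr :=
  lam ofIterT ⬝ (lam (lam iterT) ⬝ b ⬝ c)

/-- The values of `G` at long sequences, as a term. -/
def baseG : Tm [] .appr := lam (lam (lam (v2 ⬝ NSA.cat v1 (lam zero))))

/-- The branching of `G`, as a term. -/
def branchG : Tm [] (.nat ⇒ .nat ⇒ .nat ⇒ .nat) := lam (lam (lam v0))

/-- The values of `H` at long sequences, as a term. -/
def baseH : Tm [] .appr :=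
  lam (lam (lam (v2 ⬝ lam (ifZero (NSA.monus v0 v1) (NSA.nth v2 v0) zero))))

/-- The branching of `H`, as a term. -/
def branchH : Tm [] (.nat ⇒ .nat ⇒ .nat ⇒ .nat) :=
  lam (lam (lam (ifZero (NSA.monus (succ v1) v2) v0 zero)))

theorem sat_CA {Γ : List Ty} (e : Env M Γ) (G H : Tm Γ .appr) (F : Tm Γ .gam) : (CA G H F).Sat e ↔
    ∀ Y, M.st Y → Cont Y → ∀ s, M.st s → ∀ N, ¬ M.st N →
      G.eval e Y s N = H.eval e Y s N ∧ H.eval e Y s N = F.eval e Y s := by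
  simp [CA]

variable [ModelsP M]

theorem exists_eq_iff {b : M.El .one → Prop} {f : M.El .one} {g : M.El .nat → M.El .nat}
    (h : ∀ n, f n = g n) : (∃ a : M.El .one, (∀ n, a n = g n) ∧ b a) ↔ b f := by
  refine ⟨fun ⟨a, ha, hb⟩ => ?_, fun hb => ⟨f, h, hb⟩⟩
  rwa [← app_ext fun n => (ha n).trans (h n).symm]

theorem isRec_solT (b : Tm [] .appr) (c : Tm [] (.nat ⇒ .nat ⇒ .nat ⇒ .nat)) :
    IsRec (M := M) (b.eval .nil) (c.eval .nil) ((solT b c).eval .nil) := by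
  let b' : M.El .appr := b.eval .nil
  let c' : M.El (.nat ⇒ .nat ⇒ .nat ⇒ .nat) := c.eval .nil
  let A := iterT.eval ((Env.nil.ext b').ext c')
  have A_eq (Y N k) : A Y N k =
      recN ((lam (.var (.s (.s (.s (.s .z)))) ⬝ v2 ⬝ v0 ⬝ v1)).eval
        ((((Env.nil.ext b').ext c').ext Y).ext N))
        (stepT.eval ((((Env.nil.ext b').ext c').ext Y).ext N)) k := by
    simp only [A, iterT, eval_lam]
    rfl
  have A_zero (Y s N) : A Y N 0 s = b' Y s N := by simp [A_eq]
  have A_suc (Y s N k) : ∃ a : M.El .one, (∀ n, a n = c' N n (A Y N k (snoc s (suc n)))) ∧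
      A Y N (suc k) s = Y (cat (snoc s 0) a) := by
    rw [A_eq Y N (suc k), recN_suc, ← A_eq Y N k]
    generalize A Y N k = r
    refine ⟨(lam (.var (.s (.s (.s (.s (.s (.s .z)))))) ⬝ .var (.s (.s (.s (.s .z)))) ⬝ v0 ⬝
      (v3 ⬝ NSA.snoc v1 (succ v0)))).eval
      (((((((Env.nil.ext b').ext c').ext Y).ext N).ext r).ext k).ext s), fun n => by simp, ?_⟩
    simp [stepT]
  have hX (Y s N) : (solT b c).eval .nil Y s N = A Y N (monus N (len s)) s := by
    simp [solT, ofIterT, A, b', c']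
  refine fun Y s N => ⟨fun h => ?_, fun h => ?_⟩
  · rw [hX, le_def.1 h, A_zero]
  · rcases zero_or_suc (monus N (len s)) with h1 | ⟨k, h1⟩
    · exact absurd h1 h
    · obtain ⟨a, ha, h2⟩ := A_suc Y s N k
      refine ⟨a, fun n => ?_, by rw [hX, h1, h2]⟩
      rw [ha, hX, len_snoc, monus_suc, h1, pred_suc]

theorem IsRec.unique {b : M.El .appr} {c : M.El (.nat ⇒ .nat ⇒ .nat ⇒ .nat)} {X X' : M.El .appr}
    (h : IsRec b c X) (h' : IsRec b c X') : X = X' := by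
  have key : ∀ k, ∀ Y s N, monus N (len s) = k → X Y s N = X' Y s N := by
    refine nat_induction ⟨[.appr, .appr], .all .two (.all (.seq .nat) (.all .nat
      (.imp (.eq (NSA.monus v0 (NSA.len v1)) v3)
        (.eq (.var (.s (.s (.s (.s (.s .z))))) ⬝ v2 ⬝ v1 ⬝ v0)
          (.var (.s (.s (.s (.s .z)))) ⬝ v2 ⬝ v1 ⬝ v0))))), (Env.nil.ext X).ext X', by simp,
      fun x => by simp⟩ (fun Y s N hk => ?_) fun k ih Y s N hk => ?_
    · rw [(h Y s N).1 hk, (h' Y s N).1 hk]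
    · have hle : ¬ N ≤ len s := by
        rw [le_def, hk]
        exact suc_ne_zero k
      obtain ⟨a, ha, h1⟩ := (h Y s N).2 hle
      obtain ⟨a', ha', h1'⟩ := (h' Y s N).2 hle
      have : a = a' := app_ext fun n => by
        rw [ha, ha', ih Y _ N]
        rw [len_snoc, monus_suc, hk, pred_suc]
      rw [h1, h1', this]
  exact app_ext fun Y => app_ext fun s => app_ext fun N => key _ Y s N rfl

/-- A solution of the recursion with closed data is standard, being the value of a closed term. -/
theorem IsRec.isApprox {b : Tm [] .appr} {c : Tm [] (.nat ⇒ .nat ⇒ .nat ⇒ .nat)} {X : M.El .appr}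
    (h : IsRec (b.eval .nil) (c.eval .nil) X)
    (hc : ∀ N n v : M.El .nat, suc n ≤ N → c.eval .nil N n v = v) : IsApprox X := by
  refine ⟨?_, fun Y s N hN => ?_⟩
  · rw [h.unique (isRec_solT b c)]
    exact st_eval st_nil _
  · obtain ⟨a, ha, h1⟩ := (h Y s N).2 hN
    exact ⟨a, h1, fun n hn => by rw [ha, hc _ _ _ hn]⟩

theorem branchG_apply (N n v : M.El .nat) : branchG.eval .nil N n v = v := by simp [branchG]

theorem branchH_apply (N n v : M.El .nat) :
    branchH.eval .nil N n v = if suc n ≤ N then v else 0 := by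
  simp [branchH, le_def]
  rfl

variable {Γ : List Ty} (e : Env M Γ)

theorem sat_recG (G : Tm Γ .appr) :
    (recG G).Sat e ↔ IsRec (baseG.eval .nil) (branchG.eval .nil) (G.eval e) := by
  simp only [recG, Fm.sat_all, Fm.sat_and, Fm.sat_imp, Fm.sat_neg, Fm.sat_le, Fm.sat_eq]
  refine forall_congr' fun Y => forall_congr' fun s => forall_congr' fun N => and_congr ?_ ?_
  · simp [baseG]
    rfl
  · simp only [eval_len, Tm.eval_v0, Tm.eval_v1]
    refine imp_congr_right fun _ => ?_
    rw [exists_eq_iff (f := (lam (G.wk.wk.wk.wk ⬝ v3 ⬝ NSA.snoc v2 (succ v0) ⬝ v1)).eval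
      (((e.ext Y).ext s).ext N)) (fun n => by simp [branchG_apply])]
    simp

theorem sat_recH (H : Tm Γ .appr) :
    (recH H).Sat e ↔ IsRec (baseH.eval .nil) (branchH.eval .nil) (H.eval e) := by
  simp only [recH, Fm.sat_all, Fm.sat_and, Fm.sat_imp, Fm.sat_neg, Fm.sat_le, Fm.sat_eq]
  refine forall_congr' fun Y => forall_congr' fun s => forall_congr' fun N => and_congr ?_ ?_
  · simp [baseH]
    rfl
  · simp only [eval_len, Tm.eval_v0, Tm.eval_v1]
    refine imp_congr_right fun _ => ?_
    rw [exists_eq_iff (f := (lam (ifZero (NSA.monus (succ v0) v1)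
      (H.wk.wk.wk.wk ⬝ v3 ⬝ NSA.snoc v2 (succ v0) ⬝ v1) zero)).eval
      (((e.ext Y).ext s).ext N)) (fun n => by simp [branchH_apply, le_def])]
    simp

theorem sat_GHst (F : Tm Γ .gam) : (GHst F).Sat e ↔ IsGH (F.eval e) := by
  simp only [GHst, Fm.sat_allst, Fm.sat_imp, Fm.sat_cont, Tm.eval_v0]
  refine forall_congr' fun Y => imp_congr_right fun _ => imp_congr_right fun _ =>
    forall_congr' fun s => imp_congr_right fun _ => ?_
  rw [exists_eq_iff (f := (lam (F.wk.wk.wk ⬝ v2 ⬝ NSA.snoc v1 (succ v0))).eval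
    ((e.ext Y).ext s)) (fun n => by simp)]
  simp

end Str
end NSA

open NSA
theorem corollary4p2 :
    -- the canonical approximations are (closed terms for) primitive recursive functionals
    (∃ tG tH : Tm [] Ty.appr, Proves P (recG tG) ∧ Proves P (recH tH)) ∧
    -- for the functionals `G` (index one) and `H` (index zero) with these recursions:
    Proves (P ∪ {NPC, STP})
      (.all .appr (.all .appr (.imp (recG v1) (.imp (recH v0)
        (Fm.and
          (Fm.exst .gam (Fm.and (GHst v0) (CA v2 v1 v0)))
          (.all .gam (.imp (GHst v0) (CA v2 v1 v0)))))))) := by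
  refine ⟨⟨Str.solT Str.baseG Str.branchG, Str.solT Str.baseH Str.branchH,
    proves_of_forall_sat fun M hM => ?_, proves_of_forall_sat fun M hM => ?_⟩,
    proves_of_forall_sat fun M hM => ?_⟩
  · have : ModelsP M := ⟨hM⟩
    exact (Str.sat_recG _ _).2 (Str.isRec_solT _ _)
  · have : ModelsP M := ⟨hM⟩
    exact (Str.sat_recH _ _).2 (Str.isRec_solT _ _)
  · have : ModelsP M := ⟨fun ψ hψ => hM ψ (.inl hψ)⟩
    have hN : M.HasNPC := Str.hasNPC_iff.1 (hM NPC (.inr (.inl rfl)))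
    have hS : M.HasSTP := Str.hasSTP_of_sat (hM STP (.inr (.inr rfl)))
    intro G H hG hH
    rw [Str.sat_recG] at hG
    rw [Str.sat_recH] at hH
    obtain ⟨F, hF, hGH, hlim⟩ := hN.exists_limit (hG.isApprox fun N n v _ =>
      Str.branchG_apply N n v)
    obtain ⟨F', hF', hGH', hlim'⟩ := hN.exists_limit (hH.isApprox fun N n v h => by
      rw [Str.branchH_apply, if_pos h])
    simp only [Fm.sat_and, Fm.sat_exst, Fm.sat_all, Fm.sat_imp, Str.sat_GHst, Str.sat_CA]
    -- both limits, and all Gandy-Hyland functionals, agree with `F` at standard arguments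
    have key (Φ : M.El .gam) (hΦ : Str.IsGH Φ) (Y) (hY : M.st Y) (hc : Str.Cont Y) (s)
        (hs : M.st s) (N) (hNst : ¬ M.st N) : G Y s N = H Y s N ∧ H Y s N = Φ Y s := by
      have h1 : F' Y s = F Y s := hGH.eq_of_st hN hS hF hGH' hY hc hs
      have h2 : Φ Y s = F Y s := hGH.eq_of_st hN hS hF hΦ hY hc hs
      have h3 : G Y s N = F Y s := hlim Y hY hc s hs N hNst
      have h4 : H Y s N = F' Y s := hlim' Y hY hc s hs N hNst
      exact ⟨by rw [h3, h4, h1], by rw [h4, h1, h2]⟩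
    exact ⟨⟨F, hF, hGH, key F hGH⟩, key⟩
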